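/- Let $0\le l<d$, let $I=[0,2\pi]$, and let $A_1,\dots,A_l\in\mathfrak{so}(d)$ be linearly independent, $A_k=(a^k_{ij})$, with span $W$. The (step-two) Carnot group $G$ with Carnot group structure $W$ is $\mathbb R^d\times\mathbb R^l$, with coordinates $(x,y)$ and identity $e=0$, endowed with the distribution $\Delta$ that has the orthonormal frame $$E_i(x,y)=\frac{\partial}{\partial x_i}-\frac12\sum_{k=1}^l\sum_{j=1}^d a^k_{ij}x_j\frac{\partial}{\partial y_k},\qquad i=1,\dots,d;$$ write $\Delta^2=\{x=0\}$ for the vertical layer. Admissible curves $\gamma_u$ starting at $e$ (solutions of $\dot\gamma=\sum_i u_iE_i(\gamma)$, $\gamma(0)=e$) are identified with their controls $u\in L^2(I,\mathbb R^d)$. The end-point map is $$F(u)=\gamma_u(2\pi)=\Big(\int_0^{2\pi}u\,dt,\ \Big(\tfrac12\int_0^{2\pi}\Big\langle\int_0^tu(\tau)\,d\tau,\,A_ku(t)\Big\rangle dt\Big)_{k=1}^l\Big),$$ and $\Omega_p=F^{-1}(p)\subset L^2(I,\mathbb R^d)$ has the induced topology. The energy is $J(u)=\frac12\|u\|_{L^2}^2$.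 When $p$ is a regular value of $F$, the geodesics between $e$ and $p$ are the critical points of $J|_{\Omega_p}$, i.e. the $u\in\Omega_p$ such that $d_uJ$ vanishes on $\ker d_uF$. Assume $d>l$. For the generic Carnot group structure $W$ (for all $W$ in a set of $l$-planes in $\mathfrak{so}(d)$ that is open and dense), and for the generic $p\in G\setminus\Delta^2$ (for all $p\in G\setminus\Delta^2$ outside a closed set of Lebesgue measure zero), the following hold: $p$ is a regular value of $F$; there are only finitely many geodesics between $e$ and $p$; and the homology of $\Omega_p\cap\{J\le s\}$ stabilizes as $s\to\infty$, that is, there is $s_0$ such that for all $t\ge s\ge s_0$ the inclusion $\Omega_p\cap\{J\le s\}\hookrightarrow\Omega_p\cap\{J\le t\}$ induces isomorphisms on singular homology in all degrees and with coefficients in any commutative ring. -/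

import Mathlib

open scoped InnerProductSpace

noncomputable section

namespace StepTwoCarnot

/-- The Lie algebra `𝔰𝔬(d)` of real skew-symmetric `d × d` matrices. -/
abbrev so (d : ℕ) : Type := LieAlgebra.Orthogonal.so (Fin d) ℝ

/-- The underlying manifold `ℝ^d × ℝ^l` of the Carnot group, with coordinates `(x, y)`.
Its identity element `e` is the origin. -/
abbrev G (d l : ℕ) : Type := EuclideanSpace ℝ (Fin d) × EuclideanSpace ℝ (Fin l)

/-- The vertical layer `Δ² = {(0, y)}`. -/
def verticalLayer (d l : ℕ) : Set (G d l) := {p | p.1 = 0}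

/-- The space `L²([0, 2π], ℝ^d)` of controls. -/
abbrev Control (d : ℕ) : Type :=
  MeasureTheory.Lp (EuclideanSpace ℝ (Fin d)) 2
    (MeasureTheory.volume.restrict (Set.Icc (0 : ℝ) (2 * Real.pi)))

variable {d l : ℕ}

/-- The orthonormal frame
`E_i(x, y) = ∂/∂x_i - (1/2) ∑_k ∑_j a^k_{ij} x_j ∂/∂y_k` of the distribution `Δ`,
where `A k = (a^k_{ij})`. -/
def frame (A : Fin l → so d) (i : Fin d) (q : G d l) : G d l :=
  (EuclideanSpace.single i 1,
    WithLp.toLp 2 fun k => -(1 / 2) * ∑ j, (A k : Matrix (Fin d) (Fin d) ℝ) i j * q.1 j)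

/-- The horizontal part `x(t) = ∫₀ᵗ u` of the admissible curve with control `u`. -/
def horizontalPart (u : Control d) (t : ℝ) : EuclideanSpace ℝ (Fin d) :=
  ∫ τ in (0 : ℝ)..t, u τ

/-- The vertical part `y_k(t) = (1/2) ∫₀ᵗ ⟨x(τ), A_k u(τ)⟩ dτ` of the admissible curve with
control `u`. -/
def verticalPart (A : Fin l → so d) (u : Control d) (t : ℝ) : EuclideanSpace ℝ (Fin l) :=
  WithLp.toLp 2 fun k => (1 / 2) * ∫ τ in (0 : ℝ)..t,
    ⟪horizontalPart u τ,
      Matrix.toEuclideanLin (A k : Matrix (Fin d) (Fin d) ℝ) (u τ)⟫_ℝ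

/-- The admissible curve `γ_u` with control `u`, i.e. the solution of
`γ' = ∑ i, u_i E_i(γ)`, `γ(0) = e`; see `admissibleCurve_eq`. -/
def admissibleCurve (A : Fin l → so d) (u : Control d) (t : ℝ) : G d l :=
  (horizontalPart u t, verticalPart A u t)

theorem sum_smul_frame (A : Fin l → so d) (v : EuclideanSpace ℝ (Fin d)) (q : G d l) :
    ∑ i, v i • frame A i q = (v, WithLp.toLp 2 fun k => (1 / 2) *
      ⟪q.1, Matrix.toEuclideanLin (A k : Matrix (Fin d) (Fin d) ℝ) v⟫_ℝ) := by
  have hA : ∀ k i j, (A k : Matrix (Fin d) (Fin d) ℝ) i j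
      = -(A k : Matrix (Fin d) (Fin d) ℝ) j i := by
    intro k i j
    have h := (LieAlgebra.Orthogonal.mem_so (Fin d) ℝ _).1 (A k).2
    have h2 := congrFun (congrFun h j) i
    simpa [Matrix.transpose_apply] using h2
  refine Prod.ext ?_ ?_
  · ext j
    simp [frame, Prod.fst_sum, Finset.sum_apply, Pi.single_apply]
  · ext k
    simp only [frame, Prod.snd_sum, Prod.smul_snd, WithLp.ofLp_sum, WithLp.ofLp_smul,
      Finset.sum_apply, Pi.smul_apply, smul_eq_mul, PiLp.inner_apply, Matrix.toLpLin_apply,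
      Matrix.mulVec, dotProduct, RCLike.inner_apply, conj_trivial, Finset.mul_sum, Finset.sum_mul]
    rw [Finset.sum_comm]
    refine Finset.sum_congr rfl fun j _ => Finset.sum_congr rfl fun i _ => ?_
    rw [hA k i j]
    ring

theorem control_intervalIntegrable (u : Control d) {t : ℝ} (ht : t ∈ Set.Icc 0 (2 * Real.pi)) :
    IntervalIntegrable u MeasureTheory.volume 0 t := by
  rw [intervalIntegrable_iff_integrableOn_Icc_of_le ht.1]
  have h : MeasureTheory.Integrable u
      (MeasureTheory.volume.restrict (Set.Icc (0 : ℝ) (2 * Real.pi))) :=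
    (MeasureTheory.Lp.memLp u).integrable (by norm_num)
  exact MeasureTheory.IntegrableOn.mono_set h (Set.Icc_subset_Icc_right ht.2)

theorem verticalIntegrand_intervalIntegrable (A : Fin l → so d) (u : Control d) (k : Fin l)
    {t : ℝ} (ht : t ∈ Set.Icc 0 (2 * Real.pi)) :
    IntervalIntegrable (fun τ => ⟪horizontalPart u τ,
      Matrix.toEuclideanLin (A k : Matrix (Fin d) (Fin d) ℝ) (u τ)⟫_ℝ)
      MeasureTheory.volume 0 t := by
  have hu := control_intervalIntegrable u ht
  set L := (Matrix.toEuclideanLin (A k : Matrix (Fin d) (Fin d) ℝ)).toContinuousLinearMap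
  have hL : IntervalIntegrable (fun τ => L (u τ)) MeasureTheory.volume 0 t :=
    ⟨L.integrable_comp hu.1, L.integrable_comp hu.2⟩
  have hx : ContinuousOn (horizontalPart u) (Set.uIcc 0 t) := by
    refine intervalIntegral.continuousOn_primitive_interval ?_
    rw [Set.uIcc_of_le ht.1]
    exact (intervalIntegrable_iff_integrableOn_Icc_of_le ht.1).1 hu
  have h : ∀ j, IntervalIntegrable (fun τ => horizontalPart u τ j * L (u τ) j)
      MeasureTheory.volume 0 t := by
    intro j
    have hLj : IntervalIntegrable (fun τ => L (u τ) j) MeasureTheory.volume 0 t :=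
      ⟨(EuclideanSpace.proj (𝕜 := ℝ) j).integrable_comp hL.1,
        (EuclideanSpace.proj (𝕜 := ℝ) j).integrable_comp hL.2⟩
    exact hLj.continuousOn_mul ((EuclideanSpace.proj (𝕜 := ℝ) j).continuous.comp_continuousOn hx)
  have hsum := IntervalIntegrable.sum Finset.univ fun j _ => h j
  refine hsum.congr fun τ _ => ?_
  simp [PiLp.inner_apply, L, mul_comm]

/-- `γ_u` solves the Cauchy problem `γ' = ∑ i, u_i E_i(γ)`, `γ(0) = e`, in integrated form. -/
theorem admissibleCurve_eq (A : Fin l → so d) (u : Control d) {t : ℝ}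
    (ht : t ∈ Set.Icc 0 (2 * Real.pi)) :
    admissibleCurve A u t =
      ∫ τ in (0 : ℝ)..t, ∑ i, u τ i • frame A i (admissibleCurve A u τ) := by
  have hy := fun k => (verticalIntegrand_intervalIntegrable A u k ht).const_mul (1 / 2)
  have hu := control_intervalIntegrable u ht
  simp only [sum_smul_frame]
  have hV : ∀ k, MeasureTheory.Integrable (fun τ => (WithLp.toLp 2 fun k => (1 / 2) *
      ⟪(admissibleCurve A u τ).1, Matrix.toEuclideanLin (A k : Matrix (Fin d) (Fin d) ℝ) (u τ)⟫_ℝ :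
        EuclideanSpace ℝ (Fin l)) k) (MeasureTheory.volume.restrict (Set.Ioc 0 t)) :=
    fun k => (hy k).1
  rw [intervalIntegral.integral_of_le ht.1, integral_pair hu.1
    (MeasureTheory.Integrable.of_eval_piLp hV)]
  refine Prod.ext ?_ ?_
  · exact intervalIntegral.integral_of_le ht.1
  · ext k
    rw [MeasureTheory.eval_integral_piLp hV]
    simp only [admissibleCurve, verticalPart]
    rw [intervalIntegral.integral_of_le ht.1, MeasureTheory.integral_const_mul]

/-- The end-point map `F(u) = γ_u(2π)`. -/
def endpointMap (A : Fin l → so d) (u : Control d) : G d l :=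
  admissibleCurve A u (2 * Real.pi)

/-- The energy `J(γ_u) = (1/2) ∫ ‖γ_u'(t)‖² dt = ‖u‖² / 2`, with the `L²` norm. -/
def energy (u : Control d) : ℝ := ‖u‖ ^ 2 / 2

/-- `p` is a regular value of the end-point map. -/
def IsRegularEndpoint (A : Fin l → so d) (p : G d l) : Prop :=
  ∀ u : Control d, endpointMap A u = p → Function.Surjective (fderiv ℝ (endpointMap A) u)

/-- The geodesics joining `e` to `p`: the critical points of `J` restricted to `Ω_p = F⁻¹(p)`,
i.e. the `u ∈ Ω_p` such that `d_u J` vanishes on the tangent space `T_u Ω_p = ker d_u F`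
(used at regular values `p` of `F`). -/
def geodesics (A : Fin l → so d) (p : G d l) : Set (Control d) :=
  {u | endpointMap A u = p ∧
    ∀ v : Control d, fderiv ℝ (endpointMap A) u v = 0 → fderiv ℝ energy u v = 0}

/-- The space `Ω_p ∩ {J ≤ s}`, with the topology induced by `L²`. -/
def sublevel (A : Fin l → so d) (p : G d l) (s : ℝ) : Set (Control d) :=
  {u | endpointMap A u = p ∧ energy u ≤ s}

theorem sublevel_mono (A : Fin l → so d) (p : G d l) {s t : ℝ} (h : s ≤ t) :
    sublevel A p s ⊆ sublevel A p t :=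
  fun _ hu => ⟨hu.1, hu.2.trans h⟩

/-- The inclusion `Ω_p ∩ {J ≤ s} ↪ Ω_p ∩ {J ≤ t}` for `s ≤ t`. -/
def sublevelInclusion (A : Fin l → so d) (p : G d l) {s t : ℝ} (h : s ≤ t) :
    TopCat.of (sublevel A p s) ⟶ TopCat.of (sublevel A p t) :=
  TopCat.ofHom ⟨Set.inclusion (sublevel_mono A p h), continuous_inclusion _⟩

/-- The map induced by the inclusion on `n`-th singular homology with coefficients in `R`. -/
def sublevelHomologyMap (R : Type) [CommRing R] (n : ℕ)
    (A : Fin l → so d) (p : G d l) {s t : ℝ} (h : s ≤ t) :=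
  ((AlgebraicTopology.singularHomologyFunctor (ModuleCat.{0} R) n).obj
    (ModuleCat.of R R)).map (sublevelInclusion A p h)

/-- The bases of the `l`-dimensional subspaces of `𝔰𝔬(d)` that belong to `𝒲`. -/
def basesIn (l : ℕ) (𝒲 : Set (Submodule ℝ (so d))) : Set (Fin l → so d) :=
  {A | LinearIndependent ℝ A ∧ Submodule.span ℝ (Set.range A) ∈ 𝒲}

/-- A property of points of the Grassmannian of `l`-planes of `𝔰𝔬(d)`, given as a set `𝒲` of
subspaces, is generic if it holds on an open dense set of planes. The topology is tested on bases:
the space of bases is an open dense subset of `𝔰𝔬(d)^l` when `l ≤ dim 𝔰𝔬(d)`, and its projection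
to the Grassmannian is an open quotient map. -/
def IsGenericStructure (l : ℕ) (𝒲 : Set (Submodule ℝ (so d))) : Prop :=
  IsOpen (basesIn l 𝒲) ∧ Dense (basesIn l 𝒲)

/-- A property holds for the generic non-vertical point of `G` if it holds at all non-vertical
points outside a closed set of Lebesgue measure zero; it then holds on an open dense set. -/
def ForGenericNonvertical (P : G d l → Prop) : Prop :=
  ∃ N : Set (G d l), IsClosed N ∧ MeasureTheory.volume N = 0 ∧
    ∀ p : G d l, p ∉ verticalLayer d l → p ∉ N → P p

end StepTwoCarnot

end

/-!
Let `B_ω = ∑ k, ω k • A k`, and for a control `u` let `x(t) = ∫₀ᵗ u`. The transpose of `d_u F` sends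
a covector `(ξ, ω)` to the control `ξ + B_ω x(2π) / 2 - B_ω x(t)` (`inner_gradient`). So geodesics
satisfy `u = c - B_ω x(t)` with a constant vector `c`, and there `x(0) = 0` while `x(2π)` is the
horizontal part of the end-point `p`.

*Genericity.* Since `l < d`, for generic `A` there is a vector `x` with `A₁ x, …, A_l x` linearly
independent, and then almost every `x` has this property (`nondegenerate`). In this case
`κ ‖ω‖ ≤ ‖B_ω x‖` for some `κ > 0`. All of the theorem is deduced from this lower bound at the
horizontal part of `p`.

*A priori estimate.* Let `u = z + η` with `z = c - B_ω x(t)` and `‖η‖ ≤ 1`. Because `B_ω` is skew,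
`‖z(t)‖²` has derivative `-2 ⟪z, B_ω η⟫`, so it is almost constant, and since the end values `c` and
`c - B_ω x(2π)` of `z` differ by `B_ω x(2π)`, both `‖ω‖` and `‖c‖` are bounded by a multiple
of `‖z‖` (`multiplier_le`). Pairing the equation with `u` gives
`‖u‖² = ⟪c, x(2π)⟫ + 2 ⟪ω, y⟫ + ⟪η, u⟫` for the vertical part `y` of `p`; the right-hand side is of
first order in `‖u‖`, so `u`, `c` and `ω` are bounded in terms of `p`
(`exists_bound_of_almost_critical`). The same argument bounds the transpose of `d_u F` from below
(`exists_norm_le_mul_norm_gradient`), which shows that `p` is a regular value.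

*Stabilization.* By the estimate, the gradient of the energy along `F⁻¹(p)` has norm at least one
above some energy level. It extends to a vector field that is Lipschitz on bounded sets, whose
normalized flow preserves `F⁻¹(p)` and pushes each high sublevel into any lower one above that level
in finite time. Homotopy invariance of singular homology does the rest.

*Finiteness.* The operator `1 + B_ω ∫₀ᵗ` on `L²` is invertible, so geodesics are parametrized by the
initial data `(c, ω)`, and their end-points are given by a `C¹` map between spaces of the same
dimension (`expMap`). The estimate with `η = 0` shows that this map is proper over the nondegenerate
points. Therefore its critical values, which form a null set by Sard's theorem, are closed there, and
the fibres over regular values are compact and discrete.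
-/

noncomputable section

open MeasureTheory

namespace StepTwoCarnot

variable {d l : ℕ}

/-! ### Operators on the space of controls -/

/-- The first layer `ℝ^d` of the group. -/
abbrev V (d : ℕ) : Type := EuclideanSpace ℝ (Fin d)

/-- Lebesgue measure on the time interval `[0, 2π]`. -/
abbrev timeMeasure : Measure ℝ := volume.restrict (Set.Icc (0 : ℝ) (2 * Real.pi))

theorem timeMeasure_real_univ : timeMeasure.real Set.univ = 2 * Real.pi := by
  simp [timeMeasure, Measure.real, Real.pi_pos.le]

theorem integral_eq_integral_timeMeasure {E : Type*} [NormedAddCommGroup E] [NormedSpace ℝ E]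
    (f : ℝ → E) : ∫ τ in (0 : ℝ)..(2 * Real.pi), f τ = ∫ τ, f τ ∂timeMeasure := by
  rw [intervalIntegral.integral_of_le Real.two_pi_pos.le, integral_Icc_eq_integral_Ioc]

theorem continuousOn_horizontalPart (u : Control d) :
    ContinuousOn (horizontalPart u) (Set.Icc 0 (2 * Real.pi)) := by
  have h := control_intervalIntegrable u (Set.right_mem_Icc.2 Real.two_pi_pos.le)
  rw [← Set.uIcc_of_le Real.two_pi_pos.le]
  refine intervalIntegral.continuousOn_primitive_interval ?_
  rw [Set.uIcc_of_le Real.two_pi_pos.le]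
  exact (intervalIntegrable_iff_integrableOn_Icc_of_le Real.two_pi_pos.le).1 h

theorem inner_horizontalPart (u : Control d) (ξ : V d) {t : ℝ}
    (ht : t ∈ Set.Icc 0 (2 * Real.pi)) :
    ⟪ξ, horizontalPart u t⟫_ℝ =
      ⟪(indicatorConstLp 2 (measurableSet_Icc (a := (0 : ℝ)) (b := t))
        (measure_ne_top timeMeasure _) ξ : Control d), u⟫_ℝ := by
  rw [L2.inner_indicatorConstLp_eq_inner_setIntegral, horizontalPart,
    intervalIntegral.integral_of_le ht.1, ← integral_Icc_eq_integral_Ioc,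
    Measure.restrict_restrict measurableSet_Icc,
    Set.inter_eq_left.2 (Set.Icc_subset_Icc_right ht.2)]

theorem norm_horizontalPart_le (u : Control d) {t : ℝ} (ht : t ∈ Set.Icc 0 (2 * Real.pi)) :
    ‖horizontalPart u t‖ ≤ √(2 * Real.pi) * ‖u‖ := by
  set ξ := horizontalPart u t
  have h := inner_horizontalPart u ξ ht
  have h1 : ⟪ξ, ξ⟫_ℝ ≤ ‖ξ‖ * √(2 * Real.pi) * ‖u‖ := by
    refine h.le.trans ((real_inner_le_norm _ _).trans ?_)
    gcongr
    rw [norm_indicatorConstLp (by simp) (by simp), ENNReal.toReal_ofNat, Real.sqrt_eq_rpow]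
    gcongr
    exact (measureReal_mono (μ := timeMeasure) (Set.subset_univ _)).trans_eq timeMeasure_real_univ
  rw [real_inner_self_eq_norm_sq] at h1
  rcases (norm_nonneg ξ).eq_or_lt with h0 | h0
  · rw [← h0]; positivity
  · nlinarith

theorem norm_le_of_forall_norm_le {u : Control d} {C : ℝ} (hC : 0 ≤ C)
    (h : ∀ᵐ t ∂timeMeasure, ‖u t‖ ≤ C) : ‖u‖ ≤ √(2 * Real.pi) * C := by
  have := Lp.norm_le_of_ae_bound hC h
  rwa [ENNReal.toReal_ofNat, ← one_div, ← Real.sqrt_eq_rpow,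
    show ((measureUnivNNReal timeMeasure : NNReal) : ℝ) = 2 * Real.pi from
      timeMeasure_real_univ] at this

theorem ae_mem_Icc : ∀ᵐ t ∂timeMeasure, t ∈ Set.Icc (0 : ℝ) (2 * Real.pi) :=
  ae_restrict_mem measurableSet_Icc

theorem memLp_horizontalPart (u : Control d) : MemLp (horizontalPart u) 2 timeMeasure := by
  refine MemLp.of_bound
    ((continuousOn_horizontalPart u).aestronglyMeasurable measurableSet_Icc)
    (√(2 * Real.pi) * ‖u‖) ?_
  filter_upwards [ae_mem_Icc] with t ht using norm_horizontalPart_le u ht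

theorem horizontalPart_congr {u : Control d} {f : ℝ → V d} (h : u =ᵐ[timeMeasure] f) {t : ℝ}
    (ht : t ∈ Set.Icc 0 (2 * Real.pi)) : horizontalPart u t = ∫ τ in (0 : ℝ)..t, f τ := by
  rw [horizontalPart, intervalIntegral.integral_of_le ht.1, intervalIntegral.integral_of_le ht.1]
  refine integral_congr_ae (ae_restrict_of_ae_restrict_of_subset ?_ h)
  exact Set.Ioc_subset_Icc_self.trans (Set.Icc_subset_Icc_right ht.2)

theorem horizontalPart_add (u v : Control d) {t : ℝ} (ht : t ∈ Set.Icc 0 (2 * Real.pi)) :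
    horizontalPart (u + v) t = horizontalPart u t + horizontalPart v t := by
  rw [horizontalPart_congr (Lp.coeFn_add u v) ht]
  exact intervalIntegral.integral_add (control_intervalIntegrable u ht)
    (control_intervalIntegrable v ht)

theorem horizontalPart_smul (c : ℝ) (u : Control d) {t : ℝ}
    (ht : t ∈ Set.Icc 0 (2 * Real.pi)) :
    horizontalPart (c • u) t = c • horizontalPart u t := by
  rw [horizontalPart_congr (Lp.coeFn_smul c u) ht]
  exact intervalIntegral.integral_smul c _

/-- The Volterra operator `u ↦ ∫₀ᵗ u` on controls. -/
def primitive : Control d →L[ℝ] Control d :=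
  LinearMap.mkContinuous
    { toFun := fun u => (memLp_horizontalPart u).toLp
      map_add' := fun u v => by
        rw [← MemLp.toLp_add]
        refine MemLp.toLp_congr _ _ ?_
        filter_upwards [ae_mem_Icc] with t ht using horizontalPart_add u v ht
      map_smul' := fun c u => by
        rw [RingHom.id_apply, ← MemLp.toLp_const_smul]
        refine MemLp.toLp_congr _ _ ?_
        filter_upwards [ae_mem_Icc] with t ht using horizontalPart_smul c u ht }
    (2 * Real.pi) fun u => by
      refine (norm_le_of_forall_norm_le (by positivity : 0 ≤ √(2 * Real.pi) * ‖u‖) ?_).trans_eq ?_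
      · filter_upwards [ae_mem_Icc, (memLp_horizontalPart u).coeFn_toLp] with t ht h
        exact (congrArg norm h).trans_le (norm_horizontalPart_le u ht)
      · rw [← mul_assoc, Real.mul_self_sqrt Real.two_pi_pos.le]

theorem primitive_coeFn (u : Control d) : primitive u =ᵐ[timeMeasure] horizontalPart u :=
  (memLp_horizontalPart u).coeFn_toLp

/-- The constant controls. -/
def const : V d →L[ℝ] Control d := Lp.constL 2 timeMeasure ℝ

theorem const_coeFn (ξ : V d) : (const ξ : Control d) =ᵐ[timeMeasure] fun _ => ξ :=
  Lp.coeFn_const 2 timeMeasure ξ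

/-- The total displacement `u ↦ ∫₀^{2π} u`, the adjoint of the inclusion of constants. -/
def total : Control d →L[ℝ] V d := ContinuousLinearMap.adjoint const

theorem inner_const_left (ξ : V d) (u : Control d) : ⟪const ξ, u⟫_ℝ = ⟪ξ, total u⟫_ℝ :=
  (ContinuousLinearMap.adjoint_inner_right const ξ u).symm

theorem total_eq (u : Control d) : total u = horizontalPart u (2 * Real.pi) := by
  refine ext_inner_left ℝ fun ξ => ?_
  rw [← inner_const_left, horizontalPart, integral_eq_integral_timeMeasure, L2.inner_def]
  rw [← integral_inner ((Lp.memLp u).integrable (by norm_num)) ξ]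
  refine integral_congr_ae ?_
  filter_upwards [const_coeFn ξ] with t ht
  rw [ht]

theorem horizontalPart_const (ξ : V d) {t : ℝ} (ht : t ∈ Set.Icc 0 (2 * Real.pi)) :
    horizontalPart (const ξ) t = t • ξ := by
  rw [horizontalPart_congr (const_coeFn ξ) ht]
  simp

theorem total_const (ξ : V d) : total (const ξ) = (2 * Real.pi) • ξ := by
  rw [total_eq, horizontalPart_const ξ (Set.right_mem_Icc.2 Real.two_pi_pos.le)]

/-- The pointwise action of linear maps of `ℝ^d` on controls. -/
def pointwise : (V d →L[ℝ] V d) →ₗ[ℝ] Control d →L[ℝ] Control d where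
  toFun S := S.compLpL 2 timeMeasure
  map_add' S T := ContinuousLinearMap.add_compLpL S T
  map_smul' c S := ContinuousLinearMap.smul_compLpL c S

theorem pointwise_coeFn (S : V d →L[ℝ] V d) (u : Control d) :
    pointwise S u =ᵐ[timeMeasure] fun t => S (u t) :=
  S.coeFn_compLpL u

theorem norm_pointwise_le (S : V d →L[ℝ] V d) (u : Control d) :
    ‖pointwise S u‖ ≤ ‖S‖ * ‖u‖ := S.norm_compLp_le u

theorem horizontalPart_pointwise (S : V d →L[ℝ] V d) (u : Control d) {t : ℝ}
    (ht : t ∈ Set.Icc 0 (2 * Real.pi)) :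
    horizontalPart (pointwise S u) t = S (horizontalPart u t) := by
  rw [horizontalPart_congr (pointwise_coeFn S u) ht]
  exact S.intervalIntegral_comp_comm (control_intervalIntegrable u ht)

theorem total_pointwise (S : V d →L[ℝ] V d) (u : Control d) :
    total (pointwise S u) = S (total u) := by
  rw [total_eq, total_eq, horizontalPart_pointwise S u (Set.right_mem_Icc.2 Real.two_pi_pos.le)]

theorem primitive_pointwise (S : V d →L[ℝ] V d) (u : Control d) :
    primitive (pointwise S u) = pointwise S (primitive u) := by
  refine Lp.ext ?_
  filter_upwards [ae_mem_Icc, primitive_coeFn (pointwise S u), pointwise_coeFn S (primitive u),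
    primitive_coeFn u] with t ht h1 h2 h3
  rw [h1, h2, h3, horizontalPart_pointwise S u ht]

/-- Skew-symmetry of an operator with respect to the inner product. -/
def IsSkew {E : Type*} [NormedAddCommGroup E] [InnerProductSpace ℝ E] (S : E →L[ℝ] E) : Prop :=
  ∀ v w, ⟪S v, w⟫_ℝ = -⟪v, S w⟫_ℝ

theorem IsSkew.inner_self {E : Type*} [NormedAddCommGroup E] [InnerProductSpace ℝ E]
    {S : E →L[ℝ] E} (hS : IsSkew S) (v : E) : ⟪v, S v⟫_ℝ = 0 := by
  have h := hS v v
  rw [real_inner_comm] at h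
  linarith

theorem IsSkew.pointwise {S : V d →L[ℝ] V d} (hS : IsSkew S) :
    IsSkew (pointwise S : Control d →L[ℝ] Control d) := by
  intro u v
  rw [L2.inner_def, L2.inner_def, ← integral_neg]
  refine integral_congr_ae ?_
  filter_upwards [pointwise_coeFn S u, pointwise_coeFn S v] with t h1 h2
  rw [h1, h2, hS]

/-! ### Integration by parts -/

/-- Integration by parts for primitives of square-integrable controls. -/
theorem integral_inner_horizontalPart (u v : Control d) {t : ℝ}
    (ht : t ∈ Set.Icc 0 (2 * Real.pi)) :
    ∫ τ in (0 : ℝ)..t, (⟪u τ, horizontalPart v τ⟫_ℝ + ⟪horizontalPart u τ, v τ⟫_ℝ) =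
      ⟪horizontalPart u t, horizontalPart v t⟫_ℝ := by
  have hint : ∀ (w : Control d) i, IntervalIntegrable (fun τ => w τ i) volume 0 t := fun w i =>
    ⟨(EuclideanSpace.proj (𝕜 := ℝ) i).integrable_comp (control_intervalIntegrable w ht).1,
      (EuclideanSpace.proj (𝕜 := ℝ) i).integrable_comp (control_intervalIntegrable w ht).2⟩
  have hcoord : ∀ (w : Control d) i, ∀ s ∈ Set.Icc 0 t,
      horizontalPart w s i = ∫ τ in (0 : ℝ)..s, w τ i := fun w i s hs =>
    ((EuclideanSpace.proj (𝕜 := ℝ) i).intervalIntegral_comp_comm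
      (control_intervalIntegrable w ⟨hs.1, hs.2.trans ht.2⟩)).symm
  have hac : ∀ (w : Control d) i,
      AbsolutelyContinuousOnInterval (fun s => ∫ τ in (0 : ℝ)..s, w τ i) 0 t := fun w i =>
    (hint w i).absolutelyContinuousOnInterval_intervalIntegral Set.left_mem_uIcc
  have hderiv : ∀ (w : Control d) i, ∀ᵐ s, s ∈ Set.uIcc 0 t →
      deriv (fun s => ∫ τ in (0 : ℝ)..s, w τ i) s = w s i := fun w i => by
    filter_upwards [(hint w i).ae_hasDerivAt_integral] with s hs hst
    exact (hs hst 0 Set.left_mem_uIcc).deriv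
  have hI : ∀ i, IntervalIntegrable (fun τ => u τ i * (∫ σ in (0 : ℝ)..τ, v σ i)
      + (∫ σ in (0 : ℝ)..τ, u σ i) * v τ i) volume 0 t := fun i =>
    ((hint u i).mul_continuousOn (hac v i).continuousOn).add
      ((hint v i).continuousOn_mul (hac u i).continuousOn)
  have hsum : ∀ i, ∫ τ in (0 : ℝ)..t, (u τ i * (∫ σ in (0 : ℝ)..τ, v σ i)
      + (∫ σ in (0 : ℝ)..τ, u σ i) * v τ i) = horizontalPart u t i * horizontalPart v t i := by
    intro i
    have h := (hac u i).integral_deriv_mul_eq_sub (hac v i)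
    rw [hcoord u i t ⟨ht.1, le_rfl⟩, hcoord v i t ⟨ht.1, le_rfl⟩]
    simp only [intervalIntegral.integral_same, mul_zero, sub_zero] at h
    rw [← h]
    refine intervalIntegral.integral_congr_ae ?_
    filter_upwards [hderiv u i, hderiv v i] with s h1 h2 hs
    rw [h1 (Set.uIoc_subset_uIcc hs), h2 (Set.uIoc_subset_uIcc hs)]
  have : ∀ τ ∈ Set.uIcc 0 t, ⟪u τ, horizontalPart v τ⟫_ℝ + ⟪horizontalPart u τ, v τ⟫_ℝ =
      ∑ i, (u τ i * (∫ σ in (0 : ℝ)..τ, v σ i) + (∫ σ in (0 : ℝ)..τ, u σ i) * v τ i) := by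
    intro τ hτ
    rw [Set.uIcc_of_le ht.1] at hτ
    simp only [PiLp.inner_apply, RCLike.inner_apply, conj_trivial, ← Finset.sum_add_distrib,
      ← hcoord _ _ τ hτ]
    exact Finset.sum_congr rfl fun i _ => by ring
  rw [intervalIntegral.integral_congr this, intervalIntegral.integral_finsetSum fun i _ => hI i]
  simp only [hsum, PiLp.inner_apply, RCLike.inner_apply, conj_trivial]
  exact Finset.sum_congr rfl fun i _ => by ring

/-- Up to the rank-`d` operator `const ∘ total`, the Volterra operator is skew-adjoint. -/
theorem inner_primitive_add (u v : Control d) :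
    ⟪u, primitive v⟫_ℝ + ⟪primitive u, v⟫_ℝ = ⟪total u, total v⟫_ℝ := by
  rw [total_eq, total_eq,
    ← integral_inner_horizontalPart u v (Set.right_mem_Icc.2 Real.two_pi_pos.le),
    integral_eq_integral_timeMeasure, L2.inner_def, L2.inner_def,
    ← integral_add (L2.integrable_inner _ _) (L2.integrable_inner _ _)]
  refine integral_congr_ae ?_
  filter_upwards [primitive_coeFn u, primitive_coeFn v] with t h1 h2
  rw [h1, h2]

/-! ### The differential of the end-point map -/

/-- The second layer `ℝ^l` of the group, identified with its dual. -/
abbrev W (l : ℕ) : Type := EuclideanSpace ℝ (Fin l)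

/-- The endomorphism of Euclidean space given by an element of `𝔰𝔬(d)`. -/
def soMap (d : ℕ) : so d →ₗ[ℝ] V d →L[ℝ] V d where
  toFun a := (Matrix.toEuclideanLin (a : Matrix (Fin d) (Fin d) ℝ)).toContinuousLinearMap
  map_add' a b := by
    rw [show ((a + b : so d) : Matrix (Fin d) (Fin d) ℝ) = a + b from rfl, map_add, map_add]
  map_smul' c a := by
    rw [show ((c • a : so d) : Matrix (Fin d) (Fin d) ℝ) = c • a from rfl, map_smul, map_smul,
      RingHom.id_apply]

theorem soMap_apply (a : so d) (v : V d) :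
    soMap d a v = Matrix.toEuclideanLin (a : Matrix (Fin d) (Fin d) ℝ) v := rfl

theorem isSkew_soMap (a : so d) : IsSkew (soMap d a) := by
  intro v w
  have hA : ∀ i j, (a : Matrix (Fin d) (Fin d) ℝ) i j = -(a : Matrix (Fin d) (Fin d) ℝ) j i := by
    intro i j
    have h2 := congrFun (congrFun ((LieAlgebra.Orthogonal.mem_so (Fin d) ℝ _).1 a.2) j) i
    simpa [Matrix.transpose_apply] using h2
  simp only [soMap_apply, PiLp.inner_apply, Matrix.toLpLin_apply, Matrix.mulVec, dotProduct,
    RCLike.inner_apply, conj_trivial, Finset.mul_sum, Finset.sum_mul, ← Finset.sum_neg_distrib]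
  rw [Finset.sum_comm]
  refine Finset.sum_congr rfl fun j _ => Finset.sum_congr rfl fun i _ => ?_
  rw [hA i j]
  ring

/-- The linear family `ω ↦ ∑ k, ω k • A k` of skew-symmetric endomorphisms. -/
def pencil (A : Fin l → so d) : W l →L[ℝ] V d →L[ℝ] V d :=
  ∑ k, (EuclideanSpace.proj (𝕜 := ℝ) k).smulRight (soMap d (A k))

theorem pencil_apply (A : Fin l → so d) (ω : W l) :
    pencil A ω = ∑ k, (ω k : ℝ) • soMap d (A k) := by
  simp [pencil]

theorem isSkew_pencil (A : Fin l → so d) (ω : W l) : IsSkew (pencil A ω) := by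
  intro v w
  simp only [pencil_apply, _root_.sum_apply, _root_.smul_apply,
    sum_inner, inner_sum, real_inner_smul_left, real_inner_smul_right, ← Finset.sum_neg_distrib]
  refine Finset.sum_congr rfl fun k _ => ?_
  rw [isSkew_soMap]
  ring

theorem norm_pencil_le (A : Fin l → so d) (ω : W l) (v : V d) :
    ‖pencil A ω v‖ ≤ ‖pencil A‖ * ‖ω‖ * ‖v‖ := (pencil A).le_opNorm₂ ω v

theorem norm_pointwise_pencil_le (A : Fin l → so d) (ω : W l) (u : Control d) :
    ‖pointwise (pencil A ω) u‖ ≤ ‖pencil A‖ * ‖ω‖ * ‖u‖ :=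
  (norm_pointwise_le _ u).trans (by gcongr; exact (pencil A).le_opNorm ω)

theorem endpointMap_eq (A : Fin l → so d) (u : Control d) :
    endpointMap A u = (total u, WithLp.toLp 2 fun k =>
      (1 / 2) * ⟪primitive u, pointwise (soMap d (A k)) u⟫_ℝ) := by
  refine Prod.ext (total_eq u).symm ?_
  ext k
  simp only [endpointMap, admissibleCurve, verticalPart]
  rw [integral_eq_integral_timeMeasure, L2.inner_def]
  congr 1
  refine integral_congr_ae ?_
  filter_upwards [primitive_coeFn u, pointwise_coeFn (soMap d (A k)) u] with t h1 h2
  rw [h1, h2, soMap_apply]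

theorem contDiff_endpointMap (A : Fin l → so d) : ContDiff ℝ 1 (endpointMap A) := by
  rw [funext (endpointMap_eq A)]
  refine total.contDiff.prodMk ?_
  rw [contDiff_euclidean]
  intro k
  exact contDiff_const.mul (primitive.contDiff.inner ℝ (pointwise (soMap d (A k))).contDiff)

theorem fst_endpointMap (A : Fin l → so d) (u : Control d) : (endpointMap A u).1 = total u := by
  rw [endpointMap_eq]

theorem inner_snd_endpointMap (A : Fin l → so d) (u : Control d) (ω : W l) :
    ⟪ω, (endpointMap A u).2⟫_ℝ = 1 / 2 * ⟪primitive u, pointwise (pencil A ω) u⟫_ℝ := by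
  rw [endpointMap_eq, pencil_apply]
  simp only [map_sum, map_smul, _root_.sum_apply, _root_.smul_apply,
    inner_sum, real_inner_smul_right, PiLp.inner_apply, RCLike.inner_apply, conj_trivial,
    Finset.mul_sum]
  exact Finset.sum_congr rfl fun k _ => by ring

/-- The transpose of the differential of the end-point map at `u`: the control that represents
`ζ ∘ d_u F` for the covector `ζ = (ξ, ω)`, namely
`t ↦ ξ + B_ω x(2π) / 2 - B_ω x(t)`, where `B_ω = ∑ k, ω k • A k` and `x(t) = ∫₀ᵗ u`. -/
def gradient (A : Fin l → so d) (u : Control d) : G d l →ₗ[ℝ] Control d where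
  toFun ζ := const (ζ.1 + (1 / 2 : ℝ) • pencil A ζ.2 (total u)) -
    pointwise (pencil A ζ.2) (primitive u)
  map_add' ζ ζ' := by
    simp only [Prod.fst_add, Prod.snd_add, map_add, _root_.add_apply, smul_add]
    abel
  map_smul' c ζ := by
    simp only [Prod.smul_fst, Prod.smul_snd, map_smul, map_add, _root_.smul_apply,
      smul_add, smul_sub, RingHom.id_apply]
    rw [smul_comm c (1 / 2 : ℝ)]

theorem gradient_apply (A : Fin l → so d) (u : Control d) (ζ : G d l) :
    gradient A u ζ = const (ζ.1 + (1 / 2 : ℝ) • pencil A ζ.2 (total u)) -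
      pointwise (pencil A ζ.2) (primitive u) := rfl

theorem inner_gradient (A : Fin l → so d) (u v : Control d) (ζ : G d l) :
    ⟪gradient A u ζ, v⟫_ℝ = ⟪ζ.1, (fderiv ℝ (endpointMap A) u v).1⟫_ℝ +
      ⟪ζ.2, (fderiv ℝ (endpointMap A) u v).2⟫_ℝ := by
  set P := pointwise (d := d) (pencil A ζ.2)
  have hF : HasFDerivAt (endpointMap A) (fderiv ℝ (endpointMap A) u) u :=
    ((contDiff_endpointMap A).differentiable one_ne_zero u).hasFDerivAt
  have h1 : HasFDerivAt (fun w => ⟪ζ.1, (endpointMap A w).1⟫_ℝ + ⟪ζ.2, (endpointMap A w).2⟫_ℝ)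
      (((innerSL ℝ ζ.1).comp (.fst ℝ _ _) + (innerSL ℝ ζ.2).comp (.snd ℝ _ _)).comp
        (fderiv ℝ (endpointMap A) u)) u :=
    ((innerSL ℝ ζ.1).comp (.fst ℝ _ _) + (innerSL ℝ ζ.2).comp (.snd ℝ _ _)).hasFDerivAt.comp u hF
  have h2 : HasFDerivAt (fun w => ⟪ζ.1, total w⟫_ℝ + 1 / 2 * ⟪primitive w, P w⟫_ℝ) _ u :=
    ((innerSL ℝ ζ.1).hasFDerivAt.comp u total.hasFDerivAt).add
      ((primitive.hasFDerivAt.inner ℝ P.hasFDerivAt).const_mul (1 / 2))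
  have h12 : (fun w => ⟪ζ.1, (endpointMap A w).1⟫_ℝ + ⟪ζ.2, (endpointMap A w).2⟫_ℝ) =
      fun w => ⟪ζ.1, total w⟫_ℝ + 1 / 2 * ⟪primitive w, P w⟫_ℝ := by
    funext w
    rw [fst_endpointMap, inner_snd_endpointMap]
  rw [h12] at h1
  have h := DFunLike.congr_fun (h1.unique h2) v
  simp only [ContinuousLinearMap.comp_apply, _root_.add_apply,
    _root_.smul_apply, ContinuousLinearMap.coe_fst', ContinuousLinearMap.coe_snd',
    ContinuousLinearMap.prod_apply, fderivInnerCLM_apply, innerSL_apply_apply, smul_eq_mul] at h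
  rw [h, gradient_apply, inner_sub_left, inner_const_left, inner_add_left, real_inner_smul_left]
  have hs := (isSkew_pencil A ζ.2).pointwise (primitive u) v
  have hb := inner_primitive_add v (P u)
  rw [show total (P u) = pencil A ζ.2 (total u) from total_pointwise _ u,
    show primitive (P u) = P (primitive u) from primitive_pointwise _ u] at hb
  rw [real_inner_comm _ v, real_inner_comm _ (total v)] at hb
  change ⟪P (primitive u), v⟫_ℝ = -⟪primitive u, P v⟫_ℝ at hs
  linarith

theorem fderiv_endpointMap_eq_zero_iff (A : Fin l → so d) (u v : Control d) :
    fderiv ℝ (endpointMap A) u v = 0 ↔ ∀ ζ, ⟪gradient A u ζ, v⟫_ℝ = 0 := by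
  constructor
  · intro h ζ
    rw [inner_gradient, h]
    simp
  · intro h
    have h1 := h (fderiv ℝ (endpointMap A) u v)
    rw [inner_gradient] at h1
    have h2 := real_inner_self_nonneg (x := (fderiv ℝ (endpointMap A) u v).1)
    have h3 := real_inner_self_nonneg (x := (fderiv ℝ (endpointMap A) u v).2)
    exact Prod.ext (inner_self_eq_zero.1 (by linarith : ⟪_, _⟫_ℝ = 0))
      (inner_self_eq_zero.1 (by linarith : ⟪_, _⟫_ℝ = 0))

theorem fderiv_energy (u v : Control d) : fderiv ℝ energy u v = ⟪u, v⟫_ℝ := by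
  have h : HasFDerivAt (fun u : Control d => ‖u‖ ^ 2 / 2) _ u :=
    (hasStrictFDerivAt_norm_sq u).hasFDerivAt.mul_const (2⁻¹ : ℝ)
  have h2 := h.fderiv
  change fderiv ℝ energy u = _ at h2
  rw [h2]
  simp

/-- Every vector splits orthogonally along the range of the transposed differential. -/
theorem exists_sub_gradient_orthogonal (A : Fin l → so d) (u w : Control d) :
    ∃ ζ, ∀ ζ', ⟪gradient A u ζ', w - gradient A u ζ⟫_ℝ = 0 := by
  set K := LinearMap.range (gradient A u)
  obtain ⟨ζ, hζ⟩ := K.starProjection_apply_mem w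
  refine ⟨ζ, fun ζ' => ?_⟩
  rw [hζ]
  exact K.sub_starProjection_mem_orthogonal w _ ⟨ζ', rfl⟩

/-- Lagrange multipliers: a geodesic is a gradient of a linear function of the end-point. -/
theorem exists_eq_gradient_of_mem_geodesics {A : Fin l → so d} {p : G d l} {u : Control d}
    (hu : u ∈ geodesics A p) : ∃ ζ, u = gradient A u ζ := by
  obtain ⟨ζ, hζ⟩ := exists_sub_gradient_orthogonal A u u
  refine ⟨ζ, sub_eq_zero.1 (inner_self_eq_zero (𝕜 := ℝ).1 ?_)⟩
  have h := hu.2 _ ((fderiv_endpointMap_eq_zero_iff A u _).2 hζ)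
  rw [fderiv_energy] at h
  rw [inner_sub_left, h, hζ, sub_zero]

theorem surjective_fderiv_endpointMap {A : Fin l → so d} {u : Control d}
    (h : Function.Injective (gradient A u)) :
    Function.Surjective (fderiv ℝ (endpointMap A) u) := by
  set D := fderiv ℝ (endpointMap A) u
  -- pairing with the gradients of the covectors identifies `D ∘ gradient` with a Gram operator
  have hinj : Function.Injective (D.toLinearMap ∘ₗ gradient A u) := by
    rw [injective_iff_map_eq_zero]
    intro ζ hζ
    have h1 := (fderiv_endpointMap_eq_zero_iff A u _).1 hζ ζ
    exact h ((inner_self_eq_zero (𝕜 := ℝ).1 h1).trans (map_zero _).symm)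
  intro q
  obtain ⟨ζ, hζ⟩ := LinearMap.surjective_of_injective hinj q
  exact ⟨_, hζ⟩

/-! ### A priori estimates -/

theorem integral_abs_inner_le (z h : Control d) :
    ∫ t, |⟪z t, h t⟫_ℝ| ∂timeMeasure ≤ ‖z‖ * ‖h‖ := by
  have hsq : ∀ u : Control d, (∫ t, ‖u t‖ ^ (2 : ℝ) ∂timeMeasure) ^ (1 / 2 : ℝ) = ‖u‖ := by
    intro u
    have : ∫ t, ‖u t‖ ^ (2 : ℝ) ∂timeMeasure = ‖u‖ ^ 2 := by
      rw [← real_inner_self_eq_norm_sq, L2.inner_def]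
      refine integral_congr_ae (Filter.Eventually.of_forall fun t => ?_)
      simp
    rw [this, ← Real.sqrt_eq_rpow, Real.sqrt_sq (norm_nonneg u)]
  have hmem : ∀ u : Control d, MemLp u (ENNReal.ofReal 2) timeMeasure := fun u => by
    simpa using Lp.memLp u
  calc ∫ t, |⟪z t, h t⟫_ℝ| ∂timeMeasure ≤ ∫ t, ‖z t‖ * ‖h t‖ ∂timeMeasure := by
        refine integral_mono_ae (L2.integrable_inner (𝕜 := ℝ) z h).abs ?_
          (Filter.Eventually.of_forall fun t => abs_real_inner_le_norm _ _)
        exact (Lp.memLp z).norm.integrable_mul (Lp.memLp h).norm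
    _ ≤ ‖z‖ * ‖h‖ := by
        rw [← hsq z, ← hsq h]
        exact integral_mul_norm_le_Lp_mul_Lq Real.HolderConjugate.two_two (hmem z) (hmem h)

/-- Along `z(t) = c - ∫₀ᵗ w` the function `‖z(t)‖²` has derivative `-2 ⟪z, w⟫ = -2 ⟪z, h⟫`, so it
varies by at most `4 ‖z‖ ‖h‖`; therefore its end values are controlled by its mean value. -/
theorem norm_sq_endpoints_le {c : V d} {w h z : Control d} (hz : z = const c - primitive w)
    (hh : ∀ᵐ t ∂timeMeasure, ⟪z t, w t⟫_ℝ = ⟪z t, h t⟫_ℝ) :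
    ‖c‖ ^ 2 ≤ ‖z‖ ^ 2 + 4 * (‖z‖ * ‖h‖) ∧ ‖c - total w‖ ^ 2 ≤ ‖z‖ ^ 2 + 4 * (‖z‖ * ‖h‖) := by
  set X := horizontalPart w
  have hzt : ∀ᵐ t ∂timeMeasure, z t = c - X t := by
    rw [hz]
    filter_upwards [Lp.coeFn_sub (const c) (primitive w), const_coeFn c, primitive_coeFn w]
      with t h1 h2 h3
    rw [h1, Pi.sub_apply, h2, h3]
  have hform : ∀ t ∈ Set.Icc 0 (2 * Real.pi),
      ‖c - X t‖ ^ 2 = ‖c‖ ^ 2 - 2 * ∫ τ in (0 : ℝ)..t, ⟪z τ, h τ⟫_ℝ := by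
    intro t ht
    have hsub : Set.Ioc 0 t ⊆ Set.Icc 0 (2 * Real.pi) :=
      Set.Ioc_subset_Icc_self.trans (Set.Icc_subset_Icc_right ht.2)
    have h1 : ∫ τ in (0 : ℝ)..t, ⟪c, w τ⟫_ℝ = ⟪c, X t⟫_ℝ :=
      (innerSL ℝ c).intervalIntegral_comp_comm (control_intervalIntegrable w ht)
    have h2 := integral_inner_horizontalPart w w ht
    have hi1 : IntervalIntegrable (fun τ => ⟪c, w τ⟫_ℝ) volume 0 t :=
      (intervalIntegrable_iff_integrableOn_Ioc_of_le ht.1).2 ((innerSL ℝ c).integrable_comp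
        (control_intervalIntegrable w ht).1)
    have hi2 : IntervalIntegrable (fun τ => ⟪w τ, X τ⟫_ℝ + ⟪X τ, w τ⟫_ℝ) volume 0 t := by
      refine (intervalIntegrable_iff_integrableOn_Ioc_of_le ht.1).2 (IntegrableOn.mono_set ?_ hsub)
      refine ((L2.integrable_inner (𝕜 := ℝ) w (primitive w)).add
        (L2.integrable_inner (𝕜 := ℝ) (primitive w) w)).congr ?_
      filter_upwards [primitive_coeFn w] with τ hτ
      rw [Pi.add_apply, hτ]
    have h3 : ∫ τ in (0 : ℝ)..t, ⟪z τ, h τ⟫_ℝ =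
        ∫ τ in (0 : ℝ)..t, (⟪c, w τ⟫_ℝ - 1 / 2 * (⟪w τ, X τ⟫_ℝ + ⟪X τ, w τ⟫_ℝ)) := by
      rw [intervalIntegral.integral_of_le ht.1, intervalIntegral.integral_of_le ht.1]
      refine integral_congr_ae (ae_restrict_of_ae_restrict_of_subset hsub ?_)
      filter_upwards [hh, hzt] with τ h4 h5
      rw [← h4, h5, inner_sub_left, real_inner_comm (X τ) (w τ)]
      ring
    rw [h3, intervalIntegral.integral_sub hi1 (hi2.const_mul _), h1,
      intervalIntegral.integral_const_mul, h2, real_inner_self_eq_norm_sq, norm_sub_sq_real]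
    ring
  have hb : ∀ t ∈ Set.Icc 0 (2 * Real.pi),
      |∫ τ in (0 : ℝ)..t, ⟪z τ, h τ⟫_ℝ| ≤ ‖z‖ * ‖h‖ := by
    intro t ht
    refine (intervalIntegral.abs_integral_le_integral_abs ht.1).trans
      (le_trans ?_ (integral_abs_inner_le z h))
    rw [intervalIntegral.integral_of_le ht.1]
    exact setIntegral_mono_set (L2.integrable_inner (𝕜 := ℝ) z h).abs
      (Filter.Eventually.of_forall fun t => abs_nonneg _)
      (Filter.Eventually.of_forall
        (Set.Ioc_subset_Icc_self.trans (Set.Icc_subset_Icc_right ht.2)))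
  have hpi : (1 : ℝ) ≤ 2 * Real.pi := by linarith [Real.pi_gt_three]
  have hmean : ∀ t ∈ Set.Icc 0 (2 * Real.pi), ‖c - X t‖ ^ 2 ≤ ‖z‖ ^ 2 + 4 * (‖z‖ * ‖h‖) := by
    intro t ht
    have h1 : ∫ _s, (‖c - X t‖ ^ 2 - 4 * (‖z‖ * ‖h‖)) ∂timeMeasure ≤ ⟪z, z⟫_ℝ := by
      rw [L2.inner_def]
      refine integral_mono_ae (integrable_const _) (L2.integrable_inner (𝕜 := ℝ) z z) ?_
      filter_upwards [hzt, ae_mem_Icc] with s hs hsI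
      rw [real_inner_self_eq_norm_sq, hs, hform t ht, hform s hsI]
      have := abs_le.1 (hb t ht)
      have := abs_le.1 (hb s hsI)
      linarith
    rw [integral_const, timeMeasure_real_univ, smul_eq_mul, real_inner_self_eq_norm_sq] at h1
    have := sq_nonneg ‖z‖
    by_contra hcon
    nlinarith
  constructor
  · have := hmean 0 ⟨le_rfl, Real.two_pi_pos.le⟩
    simpa [X, horizontalPart] using this
  · rw [total_eq]
    exact hmean _ ⟨Real.two_pi_pos.le, le_rfl⟩

theorem le_mul_of_sq_le {κ b M w : ℝ} (hκ : 0 < κ) (hb : 0 ≤ b) (hM : 0 ≤ M)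
    (h : (κ * w) ^ 2 ≤ 4 * M ^ 2 + 16 * (b * M * w)) : w ≤ (4 / κ + 16 * b / κ ^ 2) * M := by
  by_contra! hcon
  have h1 : (4 + 16 * (b / κ)) * M < κ * w := by
    have := mul_lt_mul_of_pos_left hcon hκ
    calc _ = κ * ((4 / κ + 16 * b / κ ^ 2) * M) := by field_simp
      _ < _ := this
  have hq : b = b / κ * κ := by field_simp
  set e := b / κ
  have he : 0 ≤ e := by positivity
  rw [hq] at h
  set y := κ * w
  have h2 : 16 * (e * κ * M * w) = 16 * (e * M * y) := by simp only [y]; ring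
  rw [h2] at h
  have hy : 4 * M ≤ y := by nlinarith [mul_nonneg he hM]
  have hy0 : 0 < y := by nlinarith [mul_nonneg he hM]
  nlinarith [mul_lt_mul_of_pos_right h1 hy0, mul_nonneg hM hy0.le]

/-- If `B_ω x(2π)` is bounded below by `κ ‖ω‖`, then `ω` and `c` are controlled by the norm of
`z(t) = c - B_ω x(t)`: the two end values of `z` differ by `B_ω x(2π)`, and `h` controls the variation
of `‖z(t)‖²`. -/
theorem multiplier_le (A : Fin l → so d) {κ b : ℝ} (hκ : 0 < κ) (hb : 0 ≤ b) {c : V d} {ω : W l}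
    {u z h : Control d} (hx : κ * ‖ω‖ ≤ ‖pencil A ω (total u)‖)
    (hz : z = const c - pointwise (pencil A ω) (primitive u))
    (hh : ∀ᵐ t ∂timeMeasure, ⟪z t, pencil A ω (u t)⟫_ℝ = ⟪z t, h t⟫_ℝ)
    (hhb : ‖h‖ ≤ b * ‖ω‖) :
    ‖ω‖ ≤ (4 / κ + 16 * b / κ ^ 2) * ‖z‖ ∧
      ‖c‖ ≤ (1 + 2 * b * (4 / κ + 16 * b / κ ^ 2)) * ‖z‖ := by
  have hh' : ∀ᵐ t ∂timeMeasure, ⟪z t, pointwise (pencil A ω) u t⟫_ℝ = ⟪z t, h t⟫_ℝ := by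
    filter_upwards [hh, pointwise_coeFn (pencil A ω) u] with t h1 h2
    rw [h2, h1]
  rw [← primitive_pointwise] at hz
  obtain ⟨h1, h2⟩ := norm_sq_endpoints_le hz hh'
  rw [total_pointwise] at h2
  set x := pencil A ω (total u)
  have hzh : ‖z‖ * ‖h‖ ≤ b * ‖z‖ * ‖ω‖ := by
    nlinarith [mul_le_mul_of_nonneg_left hhb (norm_nonneg z)]
  have h3 : ‖x‖ ^ 2 ≤ 2 * ‖c‖ ^ 2 + 2 * ‖c - x‖ ^ 2 := by
    have h4 : ‖x‖ ≤ ‖c‖ + ‖c - x‖ := by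
      calc ‖x‖ = ‖c - (c - x)‖ := by rw [sub_sub_cancel]
        _ ≤ _ := norm_sub_le _ _
    nlinarith [sq_nonneg (‖c‖ - ‖c - x‖), norm_nonneg x, norm_nonneg c, norm_nonneg (c - x)]
  have h4 : (κ * ‖ω‖) ^ 2 ≤ ‖x‖ ^ 2 := by gcongr
  have hω := le_mul_of_sq_le (w := ‖ω‖) hκ hb (norm_nonneg z) (by linarith)
  refine ⟨hω, ?_⟩
  set C := 4 / κ + 16 * b / κ ^ 2
  have hC : 0 ≤ C := by positivity
  refine abs_le_of_sq_le_sq' ?_ (by positivity) |>.2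
  have h5 := mul_le_mul_of_nonneg_left hω (mul_nonneg hb (norm_nonneg z))
  nlinarith [sq_nonneg (b * C * ‖z‖)]

/-- A priori bound for almost critical points: if `u` equals a gradient of the end-point map up to
an error of norm at most one, then `u` and its Lagrange multipliers are bounded in terms of the
end-point alone. -/
theorem exists_bound_of_almost_critical (A : Fin l → so d) {κ R : ℝ} (hκ : 0 < κ) (hR : 0 ≤ R) :
    ∃ C, 0 ≤ C ∧ ∀ (u η : Control d) (c : V d) (ω : W l),
      κ * ‖ω‖ ≤ ‖pencil A ω (total u)‖ → ‖endpointMap A u‖ ≤ R →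
      u = const c - pointwise (pencil A ω) (primitive u) + η → ‖η‖ ≤ 1 →
      ‖u‖ ≤ C ∧ ‖c‖ ≤ C ∧ ‖ω‖ ≤ C := by
  set a := ‖pencil A‖
  set C₁ := 4 / κ + 16 * a / κ ^ 2
  set C₂ := 1 + 2 * a * C₁
  set C₃ := C₂ * R + 2 * (C₁ * R)
  have hC₁ : 0 ≤ C₁ := by positivity
  have hC₂ : 1 ≤ C₂ := le_add_of_nonneg_right (by positivity)
  have hC₃ : 0 ≤ C₃ := by positivity
  refine ⟨(1 + C₁ + C₂) * (C₃ + 3), by positivity, fun u η c ω hx hF hu hη => ?_⟩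
  set z := u - η
  have hz : z = const c - pointwise (pencil A ω) (primitive u) := by
    simp only [z]; nth_rw 1 [hu]; abel
  have hh : ∀ᵐ t ∂timeMeasure,
      ⟪z t, pencil A ω (u t)⟫_ℝ = ⟪z t, pointwise (pencil A ω) η t⟫_ℝ := by
    filter_upwards [Lp.coeFn_sub u η, pointwise_coeFn (pencil A ω) η] with t h1 h2
    have h3 := (isSkew_pencil A ω).inner_self (z t)
    rw [h2, ← sub_eq_zero, ← inner_sub_right, ← map_sub]
    rwa [show u t - η t = z t from h1.symm]
  have hhb : ‖pointwise (pencil A ω) η‖ ≤ a * ‖ω‖ :=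
    (norm_pointwise_pencil_le A ω η).trans (mul_le_of_le_one_right (by positivity) hη)
  obtain ⟨hω, hc⟩ := multiplier_le A hκ (norm_nonneg (pencil A)) hx hz hh hhb
  change ‖ω‖ ≤ C₁ * ‖z‖ at hω
  change ‖c‖ ≤ C₂ * ‖z‖ at hc
  have hzu : ‖z‖ ≤ ‖u‖ + 1 := (norm_sub_le u η).trans (by gcongr)
  have hF1 : ‖total u‖ ≤ R := by
    rw [← fst_endpointMap A]; exact (norm_fst_le _).trans hF
  have hF2 : ‖(endpointMap A u).2‖ ≤ R := (norm_snd_le _).trans hF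
  -- the energy identity, obtained by pairing the equation of `u` with `u`
  have henergy : ‖u‖ ^ 2 = ⟪c, total u⟫_ℝ + 2 * ⟪ω, (endpointMap A u).2⟫_ℝ + ⟪η, u⟫_ℝ := by
    have h1 : ⟪u, u⟫_ℝ = ⟪const c - pointwise (pencil A ω) (primitive u) + η, u⟫_ℝ := by
      rw [← hu]
    rw [← real_inner_self_eq_norm_sq, h1, inner_add_left, inner_sub_left, inner_const_left,
      (isSkew_pencil A ω).pointwise, inner_snd_endpointMap]
    ring
  have e1 : ⟪c, total u⟫_ℝ ≤ C₂ * ‖z‖ * R :=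
    (real_inner_le_norm _ _).trans (mul_le_mul hc hF1 (norm_nonneg _) (by positivity))
  have e2 : ⟪ω, (endpointMap A u).2⟫_ℝ ≤ C₁ * ‖z‖ * R :=
    (real_inner_le_norm _ _).trans (mul_le_mul hω hF2 (norm_nonneg _) (by positivity))
  have e3 : ⟪η, u⟫_ℝ ≤ ‖u‖ :=
    (real_inner_le_norm _ _).trans (mul_le_of_le_one_left (norm_nonneg _) hη)
  have e4 : ‖u‖ ^ 2 ≤ C₃ * (‖u‖ + 1) + ‖u‖ := by
    have := mul_le_mul_of_nonneg_left hzu hC₃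
    have h5 : C₂ * ‖z‖ * R + 2 * (C₁ * ‖z‖ * R) = C₃ * ‖z‖ := by simp only [C₃]; ring
    linarith
  have hu' : ‖u‖ ≤ C₃ + 2 := by
    by_contra! hcon
    nlinarith [norm_nonneg u]
  have hz' : ‖z‖ ≤ C₃ + 3 := by linarith
  refine ⟨?_, ?_, ?_⟩
  · nlinarith
  · calc ‖c‖ ≤ C₂ * ‖z‖ := hc
      _ ≤ (1 + C₁ + C₂) * (C₃ + 3) := by gcongr; linarith
  · calc ‖ω‖ ≤ C₁ * ‖z‖ := hω
      _ ≤ (1 + C₁ + C₂) * (C₃ + 3) := by gcongr; linarith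

/-- Quantitative surjectivity of the differential of the end-point map. -/
theorem exists_norm_le_mul_norm_gradient (A : Fin l → so d) {κ R : ℝ} (hκ : 0 < κ) (hR : 0 ≤ R) :
    ∃ C, 0 ≤ C ∧ ∀ u : Control d, (∀ ω, κ * ‖ω‖ ≤ ‖pencil A ω (total u)‖) → ‖u‖ ≤ R →
      ∀ ζ, ‖ζ‖ ≤ C * ‖gradient A u ζ‖ := by
  set a := ‖pencil A‖
  set b := a * R
  set C₁ := 4 / κ + 16 * b / κ ^ 2
  set C₂ := 1 + 2 * b * C₁
  have hb : 0 ≤ b := by positivity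
  have hC₁ : 0 ≤ C₁ := by positivity
  have hC₂ : 0 ≤ C₂ := by positivity
  set T := ‖(total : Control d →L[ℝ] V d)‖ * R
  have hT : 0 ≤ T := by positivity
  refine ⟨C₁ + (C₂ + a * C₁ * T), by positivity, fun u hx hu ζ => ?_⟩
  set z := gradient A u ζ
  have hh : ∀ᵐ t ∂timeMeasure,
      ⟪z t, pencil A ζ.2 (u t)⟫_ℝ = ⟪z t, pointwise (pencil A ζ.2) u t⟫_ℝ := by
    filter_upwards [pointwise_coeFn (pencil A ζ.2) u] with t h2
    rw [h2]
  have hhb : ‖pointwise (pencil A ζ.2) u‖ ≤ b * ‖ζ.2‖ := by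
    refine (norm_pointwise_pencil_le A ζ.2 u).trans ?_
    rw [mul_right_comm]
    exact mul_le_mul_of_nonneg_right (mul_le_mul_of_nonneg_left hu (norm_nonneg (pencil A)))
      (norm_nonneg _)
  obtain ⟨hω, hc⟩ := multiplier_le A hκ hb (hx ζ.2) (gradient_apply A u ζ) hh hhb
  change ‖ζ.2‖ ≤ C₁ * ‖z‖ at hω
  change _ ≤ C₂ * ‖z‖ at hc
  have hB : ‖pencil A ζ.2 (total u)‖ ≤ a * (C₁ * ‖z‖) * T := by
    refine (norm_pencil_le A ζ.2 _).trans ?_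
    gcongr
    exact (total.le_opNorm u).trans (mul_le_mul_of_nonneg_left hu (norm_nonneg _))
  have hξ : ‖ζ.1‖ ≤ (C₂ + a * C₁ * T) * ‖z‖ := by
    have h1 : ‖ζ.1‖ ≤ ‖ζ.1 + (1 / 2 : ℝ) • pencil A ζ.2 (total u)‖ +
        ‖(1 / 2 : ℝ) • pencil A ζ.2 (total u)‖ := by
      calc ‖ζ.1‖ = ‖(ζ.1 + (1 / 2 : ℝ) • pencil A ζ.2 (total u)) -
            (1 / 2 : ℝ) • pencil A ζ.2 (total u)‖ := by rw [add_sub_cancel_right]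
        _ ≤ _ := norm_sub_le _ _
    rw [norm_smul (1 / 2 : ℝ), Real.norm_of_nonneg (by norm_num : (0 : ℝ) ≤ 1 / 2)] at h1
    nlinarith [norm_nonneg (pencil A ζ.2 (total u))]
  refine max_le (hξ.trans ?_) (hω.trans ?_)
  · exact mul_le_mul_of_nonneg_right (le_add_of_nonneg_left hC₁) (norm_nonneg z)
  · exact mul_le_mul_of_nonneg_right (le_add_of_nonneg_right (by positivity)) (norm_nonneg z)

/-! ### Deformations and singular homology -/

/-- If a subspace `Y` is deformed into `X ⊆ Y` by a homotopy that keeps `X` inside `X`, then the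
inclusion `X → Y` induces isomorphisms on singular homology. -/
theorem isIso_singularHomology_inclusion {E : Type} [TopologicalSpace E] {X Y : Set E}
    (h : X ⊆ Y) {T : ℝ} (hT : 0 ≤ T) (Φ : E × ℝ → E)
    (hΦ : ContinuousOn Φ (Y ×ˢ Set.Icc 0 T)) (h0 : ∀ y ∈ Y, Φ (y, 0) = y)
    (hY : ∀ y ∈ Y, ∀ t ∈ Set.Icc 0 T, Φ (y, t) ∈ Y)
    (hX : ∀ x ∈ X, ∀ t ∈ Set.Icc 0 T, Φ (x, t) ∈ X) (h1 : ∀ y ∈ Y, Φ (y, T) ∈ X)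
    (R : Type) [CommRing R] (n : ℕ) :
    CategoryTheory.IsIso (((AlgebraicTopology.singularHomologyFunctor (ModuleCat.{0} R) n).obj
      (ModuleCat.of R R)).map (TopCat.ofHom ⟨Set.inclusion h, continuous_inclusion h⟩ :
        TopCat.of X ⟶ TopCat.of Y)) := by
  set 𝓗 := (AlgebraicTopology.singularHomologyFunctor (ModuleCat.{0} R) n).obj (ModuleCat.of R R)
  have hs : ∀ s : unitInterval, T * (s : ℝ) ∈ Set.Icc 0 T := fun s =>
    ⟨mul_nonneg hT s.2.1, mul_le_of_le_one_right hT s.2.2⟩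
  have hcY : Continuous fun q : unitInterval × Y => Φ ((q.2 : E), T * (q.1 : ℝ)) :=
    hΦ.comp_continuous (by fun_prop) fun q => ⟨q.2.2, hs q.1⟩
  have hcX : Continuous fun q : unitInterval × X => Φ ((q.2 : E), T * (q.1 : ℝ)) :=
    hΦ.comp_continuous (by fun_prop) fun q => ⟨h q.2.2, hs q.1⟩
  have hcT : Continuous fun y : Y => Φ ((y : E), T) :=
    hΦ.comp_continuous (by fun_prop) fun y => ⟨y.2, hT, le_rfl⟩
  let i : TopCat.of X ⟶ TopCat.of Y := TopCat.ofHom ⟨Set.inclusion h, continuous_inclusion h⟩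
  let r : TopCat.of Y ⟶ TopCat.of X :=
    TopCat.ofHom ⟨fun y => ⟨Φ ((y : E), T), h1 y y.2⟩, hcT.subtype_mk _⟩
  have HY : TopCat.Homotopy (CategoryTheory.CategoryStruct.id (TopCat.of Y))
      (CategoryTheory.CategoryStruct.comp r i) :=
    { toFun := fun q => ⟨Φ ((q.2 : E), T * (q.1 : ℝ)), hY _ q.2.2 _ (hs q.1)⟩
      continuous_toFun := hcY.subtype_mk _
      map_zero_left := fun y => Subtype.ext (by
        change Φ ((y : E), T * (0 : ℝ)) = y
        rw [mul_zero, h0 _ y.2])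
      map_one_left := fun y => Subtype.ext (by
        change Φ ((y : E), T * (1 : ℝ)) = Φ ((y : E), T)
        rw [mul_one]) }
  have HX : TopCat.Homotopy (CategoryTheory.CategoryStruct.id (TopCat.of X))
      (CategoryTheory.CategoryStruct.comp i r) :=
    { toFun := fun q => ⟨Φ ((q.2 : E), T * (q.1 : ℝ)), hX _ q.2.2 _ (hs q.1)⟩
      continuous_toFun := hcX.subtype_mk _
      map_zero_left := fun y => Subtype.ext (by
        change Φ ((y : E), T * (0 : ℝ)) = y
        rw [mul_zero, h0 _ (h y.2)])
      map_one_left := fun y => Subtype.ext (by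
        change Φ ((y : E), T * (1 : ℝ)) = Φ ((y : E), T)
        rw [mul_one]) }
  have eY : 𝓗.map (CategoryTheory.CategoryStruct.id _) =
      𝓗.map (CategoryTheory.CategoryStruct.comp r i) :=
    HY.congr_homologyMap_singularChainComplexFunctor (ModuleCat.of R R) n
  have eX : 𝓗.map (CategoryTheory.CategoryStruct.id _) =
      𝓗.map (CategoryTheory.CategoryStruct.comp i r) :=
    HX.congr_homologyMap_singularChainComplexFunctor (ModuleCat.of R R) n
  rw [CategoryTheory.Functor.map_id, CategoryTheory.Functor.map_comp] at eX eY
  exact ⟨𝓗.map r, eX.symm, eY.symm⟩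

/-! ### Flows of bounded, locally Lipschitz vector fields -/

theorem exists_flow {E : Type*} [NormedAddCommGroup E] [NormedSpace ℝ E] [CompleteSpace E]
    {f : E → E} (hb : ∀ x, ‖f x‖ ≤ 1)
    (hf : ∀ R : ℝ, ∃ K, LipschitzOnWith K f (Metric.closedBall 0 R)) {R T : ℝ} (hR : 0 ≤ R)
    (hT : 0 ≤ T) :
    ∃ Φ : E × ℝ → E, (∀ x ∈ Metric.closedBall (0 : E) R, Φ (x, 0) = x ∧
      ∀ t ∈ Set.Icc 0 T, HasDerivWithinAt (fun s => Φ (x, s)) (f (Φ (x, t))) (Set.Icc 0 T) t) ∧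
      ContinuousOn Φ (Metric.closedBall 0 R ×ˢ Set.Icc 0 T) := by
  obtain ⟨K, hK⟩ := hf (R + T)
  have hPL : IsPicardLindelof (fun _ => f) (tmin := 0) (tmax := T) ⟨0, le_rfl, hT⟩ (0 : E)
      ⟨R + T, by positivity⟩ ⟨R, hR⟩ 1 K := by
    refine IsPicardLindelof.of_time_independent (fun x _ => by simpa using hb x) hK ?_
    simp only [NNReal.coe_one, one_mul, sub_zero, sub_self, max_eq_left hT]
    change T ≤ R + T - R
    linarith
  exact hPL.exists_forall_mem_closedBall_eq_hasDerivWithinAt_continuousOn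

theorem norm_smul_inv_one_add_le {E : Type*} [NormedAddCommGroup E] [NormedSpace ℝ E] (v : E) :
    ‖(1 + ‖v‖)⁻¹ • v‖ ≤ 1 := by
  have h : 0 < 1 + ‖v‖ := by positivity
  rw [norm_smul, norm_inv, Real.norm_of_nonneg h.le, inv_mul_le_one₀ h]
  linarith

theorem norm_smul_inv_one_add_sub_le {E : Type*} [NormedAddCommGroup E] [NormedSpace ℝ E]
    (v w : E) : ‖(1 + ‖v‖)⁻¹ • v - (1 + ‖w‖)⁻¹ • w‖ ≤ 2 * ‖v - w‖ := by
  have hv : 0 < 1 + ‖v‖ := by positivity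
  have hw : 0 < 1 + ‖w‖ := by positivity
  have h1 : (1 + ‖v‖)⁻¹ • v - (1 + ‖w‖)⁻¹ • w = ((1 + ‖v‖)⁻¹ * (1 + ‖w‖)⁻¹) •
      ((1 + ‖w‖) • (v - w) + (‖w‖ - ‖v‖) • w) := by
    have h2 : (1 + ‖w‖) • (v - w) + (‖w‖ - ‖v‖) • w = (1 + ‖w‖) • v - (1 + ‖v‖) • w := by module
    rw [h2, smul_sub, smul_smul, smul_smul, mul_assoc, inv_mul_cancel₀ hw.ne', mul_one,
      mul_right_comm, inv_mul_cancel₀ hv.ne', one_mul]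
  have h3 : ‖(1 + ‖w‖) • (v - w) + (‖w‖ - ‖v‖) • w‖ ≤ 2 * ‖v - w‖ * (1 + ‖w‖) := by
    refine (norm_add_le _ _).trans ?_
    rw [norm_smul, norm_smul, Real.norm_of_nonneg hw.le, Real.norm_eq_abs]
    have h4 := abs_norm_sub_norm_le w v
    rw [norm_sub_rev] at h4
    nlinarith [mul_le_mul_of_nonneg_right h4 (norm_nonneg w), norm_nonneg (v - w)]
  rw [h1, norm_smul, Real.norm_of_nonneg (by positivity)]
  calc (1 + ‖v‖)⁻¹ * (1 + ‖w‖)⁻¹ * ‖(1 + ‖w‖) • (v - w) + (‖w‖ - ‖v‖) • w‖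
      ≤ (1 + ‖v‖)⁻¹ * (1 + ‖w‖)⁻¹ * (2 * ‖v - w‖ * (1 + ‖w‖)) := by gcongr
    _ = (1 + ‖v‖)⁻¹ * (2 * ‖v - w‖) := by field_simp
    _ ≤ 1 * (2 * ‖v - w‖) := by
        gcongr
        exact inv_le_one_of_one_le₀ (le_add_of_nonneg_right (norm_nonneg v))
    _ = _ := one_mul _

/-- Stability of orthogonal projections: if `uᵢ = vᵢ + Tᵢ ζᵢ` with `vᵢ` orthogonal to the range of
`Tᵢ`, and the `Tᵢ` are bounded below, then `v₁ - v₂` is controlled by `u₁ - u₂` as soon as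
`T₁ - T₂` is. -/
theorem norm_sub_le_of_orthogonal {H Z : Type*} [NormedAddCommGroup H] [InnerProductSpace ℝ H]
    [NormedAddCommGroup Z] [NormedSpace ℝ Z] {T₁ T₂ : Z →ₗ[ℝ] H} {u₁ u₂ : H} {ζ₁ ζ₂ : Z}
    {C K R : ℝ} (hC : 0 ≤ C) (hK : 0 ≤ K)
    (hT : ∀ ζ, ‖T₁ ζ - T₂ ζ‖ ≤ K * ‖u₁ - u₂‖ * ‖ζ‖) (h₁ : ∀ ζ, ‖ζ‖ ≤ C * ‖T₁ ζ‖)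
    (h₂ : ∀ ζ, ‖ζ‖ ≤ C * ‖T₂ ζ‖) (hu : ‖u₁‖ ≤ R)
    (o₁ : ∀ ζ, ⟪T₁ ζ, u₁ - T₁ ζ₁⟫_ℝ = 0) (o₂ : ∀ ζ, ⟪T₂ ζ, u₂ - T₂ ζ₂⟫_ℝ = 0) :
    ‖(u₁ - T₁ ζ₁) - (u₂ - T₂ ζ₂)‖ ≤ (1 + 3 * (K * (C * R))) * ‖u₁ - u₂‖ := by
  have hpyth : ‖u₁‖ ^ 2 = ‖T₁ ζ₁‖ ^ 2 + ‖u₁ - T₁ ζ₁‖ ^ 2 := by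
    have h := norm_add_sq_real (T₁ ζ₁) (u₁ - T₁ ζ₁)
    rw [o₁, add_sub_cancel] at h
    linarith
  have hR : 0 ≤ R := (norm_nonneg _).trans hu
  have hTζ : ‖T₁ ζ₁‖ ≤ R := (abs_le_of_sq_le_sq' (by
    nlinarith [sq_nonneg ‖u₁ - T₁ ζ₁‖, norm_nonneg u₁]) hR).2
  have hv : ‖u₁ - T₁ ζ₁‖ ≤ R := (abs_le_of_sq_le_sq' (by
    nlinarith [sq_nonneg ‖T₁ ζ₁‖, norm_nonneg u₁]) hR).2
  have hζ : ‖ζ₁‖ ≤ C * R := (h₁ ζ₁).trans (by gcongr)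
  set q := K * (C * R)
  have hq : 0 ≤ q := by positivity
  set Δ := ‖u₁ - u₂‖
  have hΔ : 0 ≤ Δ := norm_nonneg _
  set e := (u₁ - u₂) - (T₁ ζ₁ - T₂ ζ₁)
  have he : ‖e‖ ≤ (1 + q) * Δ := by
    refine (norm_sub_le _ _).trans ?_
    have h := (hT ζ₁).trans (mul_le_mul_of_nonneg_left hζ (mul_nonneg hK hΔ))
    calc _ ≤ Δ + K * Δ * (C * R) := by gcongr
      _ = _ := by simp only [q]; ring
  set v := (u₁ - T₁ ζ₁) - (u₂ - T₂ ζ₂)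
  have hvdef : v = e - T₂ (ζ₁ - ζ₂) := by simp only [v, e, map_sub]; abel
  set δ := ζ₁ - ζ₂
  have hδ : ‖δ‖ ≤ C * ((1 + q) * Δ + ‖v‖) := by
    refine (h₂ δ).trans (mul_le_mul_of_nonneg_left ?_ hC)
    calc ‖T₂ δ‖ = ‖e - v‖ := by rw [hvdef, sub_sub_cancel]
      _ ≤ _ := (norm_sub_le _ _).trans (by gcongr)
  have h3 : ⟪v, T₂ δ⟫_ℝ = -⟪u₁ - T₁ ζ₁, T₁ δ - T₂ δ⟫_ℝ := by
    simp only [v]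
    rw [inner_sub_left, inner_sub_right, real_inner_comm (T₂ δ) (u₂ - _), o₂,
      real_inner_comm (T₁ δ) (u₁ - _), o₁]
    ring
  have h4 : ⟪u₁ - T₁ ζ₁, T₁ δ - T₂ δ⟫_ℝ ≤ q * Δ * ((1 + q) * Δ + ‖v‖) := by
    refine (real_inner_le_norm _ _).trans ?_
    calc ‖u₁ - T₁ ζ₁‖ * ‖T₁ δ - T₂ δ‖ ≤ R * (K * Δ * (C * ((1 + q) * Δ + ‖v‖))) :=
          mul_le_mul hv ((hT δ).trans (by gcongr)) (norm_nonneg _) hR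
      _ = _ := by simp only [q]; ring
  have h5 : ⟪v, e⟫_ℝ ≤ ‖v‖ * ((1 + q) * Δ) :=
    (real_inner_le_norm _ _).trans (by gcongr)
  have h6 : ‖v‖ ^ 2 = ⟪v, e⟫_ℝ - ⟪v, T₂ δ⟫_ℝ := by
    rw [← inner_sub_right, ← hvdef, real_inner_self_eq_norm_sq]
  by_contra! hcon
  have hpos : 0 < ‖v‖ := lt_of_le_of_lt (by positivity) hcon
  nlinarith [mul_lt_mul_of_pos_right hcon hpos, mul_nonneg hq hΔ,
    mul_nonneg (mul_nonneg hq hΔ) (sub_nonneg.2 hcon.le), mul_nonneg (mul_nonneg hq hΔ) hΔ,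
    mul_nonneg (mul_nonneg hq hΔ) (mul_nonneg hq hΔ)]

/-! ### The gradient flow of the energy on the fibres of the end-point map -/

/-- A multiplier `ζ` such that `gradient A u ζ` is the component of `u` normal to the fibre of the
end-point map through `u`. -/
def multiplier (A : Fin l → so d) (u : Control d) : G d l :=
  (exists_sub_gradient_orthogonal A u u).choose

/-- The gradient at `u` of the energy restricted to the fibre of the end-point map through `u`:
the component of `u` tangent to this fibre. -/
def tangentGradient (A : Fin l → so d) (u : Control d) : Control d :=
  u - gradient A u (multiplier A u)

theorem inner_gradient_tangentGradient (A : Fin l → so d) (u : Control d) (ζ : G d l) :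
    ⟪gradient A u ζ, tangentGradient A u⟫_ℝ = 0 :=
  (exists_sub_gradient_orthogonal A u u).choose_spec ζ

theorem inner_self_tangentGradient (A : Fin l → so d) (u : Control d) :
    ⟪u, tangentGradient A u⟫_ℝ = ‖tangentGradient A u‖ ^ 2 := by
  rw [← real_inner_self_eq_norm_sq]
  conv_rhs => rw [tangentGradient, inner_sub_left]
  rw [← tangentGradient, inner_gradient_tangentGradient, sub_zero]

theorem fderiv_endpointMap_tangentGradient (A : Fin l → so d) (u : Control d) :
    fderiv ℝ (endpointMap A) u (tangentGradient A u) = 0 :=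
  (fderiv_endpointMap_eq_zero_iff A u _).2 (inner_gradient_tangentGradient A u)

theorem total_tangentGradient (A : Fin l → so d) (u : Control d) :
    total (tangentGradient A u) = 0 := by
  have h := inner_gradient_tangentGradient A u (total (tangentGradient A u), 0)
  rw [gradient_apply] at h
  simp only [map_zero, _root_.zero_apply, smul_zero, add_zero, sub_zero] at h
  rw [inner_const_left] at h
  exact inner_self_eq_zero.1 h

theorem exists_norm_gradient_sub_le (A : Fin l → so d) :
    ∃ K, 0 ≤ K ∧ ∀ (u v : Control d) (ζ : G d l),
      ‖gradient A u ζ - gradient A v ζ‖ ≤ K * ‖u - v‖ * ‖ζ‖ := by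
  set a := ‖pencil A‖
  set k := ‖(const : V d →L[ℝ] Control d)‖
  set m := ‖(total : Control d →L[ℝ] V d)‖
  set i := ‖(primitive : Control d →L[ℝ] Control d)‖
  refine ⟨k * (1 / 2 * (a * m)) + a * i, by positivity, fun u v ζ => ?_⟩
  have h1 : gradient A u ζ - gradient A v ζ =
      const ((1 / 2 : ℝ) • pencil A ζ.2 (total (u - v))) -
        pointwise (pencil A ζ.2) (primitive (u - v)) := by
    simp only [gradient_apply, map_sub, map_add, smul_sub]
    abel
  have hω : ‖ζ.2‖ ≤ ‖ζ‖ := norm_snd_le ζ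
  rw [h1]
  refine (norm_sub_le _ _).trans ?_
  have h2 : ‖const ((1 / 2 : ℝ) • pencil A ζ.2 (total (u - v)))‖ ≤
      k * (1 / 2 * (a * ‖ζ‖ * (m * ‖u - v‖))) := by
    refine (const.le_opNorm _).trans (mul_le_mul_of_nonneg_left ?_ (norm_nonneg _))
    rw [norm_smul (1 / 2 : ℝ), Real.norm_of_nonneg (by norm_num : (0 : ℝ) ≤ 1 / 2)]
    refine mul_le_mul_of_nonneg_left ((norm_pencil_le A _ _).trans ?_) (by norm_num)
    exact mul_le_mul (mul_le_mul_of_nonneg_left hω (norm_nonneg (pencil A))) (total.le_opNorm _)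
      (norm_nonneg _) (by positivity)
  have h3 : ‖pointwise (pencil A ζ.2) (primitive (u - v))‖ ≤ a * ‖ζ‖ * (i * ‖u - v‖) :=
    (norm_pointwise_pencil_le A _ _).trans (mul_le_mul
      (mul_le_mul_of_nonneg_left hω (norm_nonneg (pencil A))) (primitive.le_opNorm _)
      (norm_nonneg _) (by positivity))
  calc _ ≤ k * (1 / 2 * (a * ‖ζ‖ * (m * ‖u - v‖))) + a * ‖ζ‖ * (i * ‖u - v‖) := add_le_add h2 h3
    _ = _ := by ring

/-- Retraction of the space of controls onto the controls with total displacement `x`. -/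
def withTotal (x : V d) (u : Control d) : Control d :=
  u + const ((2 * Real.pi)⁻¹ • (x - total u))

theorem total_withTotal (x : V d) (u : Control d) : total (withTotal x u) = x := by
  rw [withTotal, map_add, total_const, smul_smul, mul_inv_cancel₀ Real.two_pi_pos.ne', one_smul,
    add_sub_cancel]

theorem withTotal_of_total_eq {x : V d} {u : Control d} (h : total u = x) :
    withTotal x u = u := by
  rw [withTotal, h, sub_self, smul_zero, map_zero, add_zero]

theorem exists_norm_withTotal_sub_le (d : ℕ) : ∃ K, 0 ≤ K ∧ ∀ (x : V d) (u v : Control d),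
    ‖withTotal x u - withTotal x v‖ ≤ K * ‖u - v‖ := by
  set k := ‖(const : V d →L[ℝ] Control d)‖
  set m := ‖(total : Control d →L[ℝ] V d)‖
  have hpi : 0 < (2 * Real.pi)⁻¹ := inv_pos.2 Real.two_pi_pos
  refine ⟨1 + k * ((2 * Real.pi)⁻¹ * m), by positivity, fun x u v => ?_⟩
  have h : withTotal x u - withTotal x v = (u - v) - const ((2 * Real.pi)⁻¹ • total (u - v)) := by
    simp only [withTotal, map_sub, smul_sub]
    abel
  rw [h, add_mul, one_mul]
  refine (norm_sub_le _ _).trans (add_le_add le_rfl ((const.le_opNorm _).trans ?_))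
  rw [mul_assoc]
  refine mul_le_mul_of_nonneg_left ?_ (norm_nonneg _)
  rw [norm_smul, Real.norm_of_nonneg hpi.le, mul_assoc]
  exact mul_le_mul_of_nonneg_left (total.le_opNorm _) hpi.le

/-- The normalized negative gradient of the energy along the fibres of the end-point map, extended
from the controls with total displacement `x` to all controls by `withTotal`. -/
def descentField (A : Fin l → so d) (x : V d) (u : Control d) : Control d :=
  -((1 + ‖tangentGradient A (withTotal x u)‖)⁻¹ • tangentGradient A (withTotal x u))

theorem exists_lipschitzOnWith_descentField (A : Fin l → so d) {x : V d} {κ : ℝ} (hκ : 0 < κ)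
    (hx : ∀ ω, κ * ‖ω‖ ≤ ‖pencil A ω x‖) (R : ℝ) :
    ∃ K, LipschitzOnWith K (descentField A x) (Metric.closedBall 0 R) := by
  obtain ⟨P, hP, hPx⟩ := exists_norm_withTotal_sub_le d
  obtain ⟨K, hK, hKA⟩ := exists_norm_gradient_sub_le A
  -- the retraction maps the ball of radius `R` into the ball of radius `S`
  set S := ‖withTotal x (0 : Control d)‖ + P * |R|
  have hS : 0 ≤ S := by positivity
  have hball : ∀ u ∈ Metric.closedBall (0 : Control d) R, ‖withTotal x u‖ ≤ S := by
    intro u hu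
    rw [mem_closedBall_zero_iff] at hu
    have h := hPx x u 0
    rw [sub_zero] at h
    calc ‖withTotal x u‖ = ‖withTotal x 0 + (withTotal x u - withTotal x 0)‖ := by
          rw [add_sub_cancel]
      _ ≤ _ := (norm_add_le _ _).trans (add_le_add le_rfl (h.trans
          (mul_le_mul_of_nonneg_left (hu.trans (le_abs_self R)) hP)))
  obtain ⟨C, hC, hCA⟩ := exists_norm_le_mul_norm_gradient A hκ hS
  have hx' : ∀ u, ∀ ω, κ * ‖ω‖ ≤ ‖pencil A ω (total (withTotal x u))‖ := fun u ω => by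
    rw [total_withTotal]; exact hx ω
  refine ⟨⟨2 * ((1 + 3 * (K * (C * S))) * P), by positivity⟩,
    LipschitzOnWith.of_dist_le_mul fun u hu v hv => ?_⟩
  rw [dist_eq_norm, dist_eq_norm, descentField, descentField, neg_sub_neg, norm_sub_rev]
  refine (norm_smul_inv_one_add_sub_le _ _).trans ?_
  change _ ≤ 2 * ((1 + 3 * (K * (C * S))) * P) * ‖u - v‖
  rw [mul_assoc, mul_assoc]
  refine mul_le_mul_of_nonneg_left ?_ zero_le_two
  refine (norm_sub_le_of_orthogonal (ζ₁ := multiplier A (withTotal x u))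
    (ζ₂ := multiplier A (withTotal x v)) hC hK (hKA _ _) (hCA _ (hx' u) (hball u hu))
    (hCA _ (hx' v) (hball v hv)) (hball u hu) (inner_gradient_tangentGradient A _)
    (inner_gradient_tangentGradient A _)).trans ?_
  exact mul_le_mul_of_nonneg_left (hPx x u v) (by positivity)

/-- Beyond some energy level the energy has no almost critical points on a fibre of the end-point
map. -/
theorem exists_one_le_norm_tangentGradient (A : Fin l → so d) {p : G d l} {κ : ℝ} (hκ : 0 < κ)
    (hx : ∀ ω, κ * ‖ω‖ ≤ ‖pencil A ω p.1‖) :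
    ∃ s₀, ∀ u : Control d, endpointMap A u = p → s₀ < energy u → 1 ≤ ‖tangentGradient A u‖ := by
  obtain ⟨C, hC, hCA⟩ := exists_bound_of_almost_critical A hκ (norm_nonneg p)
  refine ⟨C ^ 2 / 2, fun u hu hs => ?_⟩
  by_contra! hcon
  set ζ := multiplier A u
  have htot : total u = p.1 := by rw [← fst_endpointMap A, hu]
  have h := (hCA u (tangentGradient A u) (ζ.1 + (1 / 2 : ℝ) • pencil A ζ.2 (total u)) ζ.2
    (by rw [htot]; exact hx _) (by rw [hu]) (by rw [← gradient_apply]; simp [tangentGradient, ζ])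
    hcon.le).1
  have : ‖u‖ ^ 2 ≤ C ^ 2 := by gcongr
  simp only [energy] at hs
  linarith

theorem eq_of_hasDerivWithinAt_zero {E : Type*} [NormedAddCommGroup E] [NormedSpace ℝ E]
    {g : ℝ → E} {T : ℝ} (h : ∀ t ∈ Set.Icc 0 T, HasDerivWithinAt g 0 (Set.Icc 0 T) t) {t : ℝ}
    (ht : t ∈ Set.Icc 0 T) : g t = g 0 := by
  have hT : 0 ≤ T := ht.1.trans ht.2
  refine constant_of_has_deriv_right_zero (fun s hs => (h s hs).continuousWithinAt)
    (fun s hs => ?_) t ht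
  exact (h s ⟨hs.1, hs.2.le⟩).mono_of_mem_nhdsWithin (Icc_mem_nhdsGE_of_mem hs)

theorem antitoneOn_Icc_of_hasDerivWithinAt_nonpos {g g' : ℝ → ℝ} {T : ℝ}
    (h : ∀ t ∈ Set.Icc 0 T, HasDerivWithinAt g (g' t) (Set.Icc 0 T) t)
    (h' : ∀ t ∈ Set.Icc 0 T, g' t ≤ 0) : AntitoneOn g (Set.Icc 0 T) :=
  antitoneOn_of_hasDerivWithinAt_nonpos (convex_Icc 0 T)
    (fun t ht => (h t ht).continuousWithinAt)
    (fun t ht => (h t (interior_subset ht)).mono interior_subset)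
    (fun t ht => h' t (interior_subset ht))

/-- For `p` with nondegenerate horizontal part, each high sublevel of the energy on the fibre over `p`
is deformed into any lower one above `s₀` by the descent flow. -/
theorem exists_forall_isIso_sublevelHomologyMap (A : Fin l → so d) {p : G d l} {κ : ℝ}
    (hκ : 0 < κ) (hx : ∀ ω, κ * ‖ω‖ ≤ ‖pencil A ω p.1‖) :
    ∃ s₀ : ℝ, ∀ (s t : ℝ) (_ : s₀ ≤ s) (hst : s ≤ t) (R : Type) [CommRing R] (n : ℕ),
      CategoryTheory.IsIso (sublevelHomologyMap R n A p hst) := by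
  obtain ⟨s₀, hs₀⟩ := exists_one_le_norm_tangentGradient A hκ hx
  refine ⟨s₀, fun s t hs hst R _ n => ?_⟩
  -- long enough to lose the energy `t - s` at rate `1 / 2`
  set T := 2 * (t - s)
  have hT : 0 ≤ T := mul_nonneg zero_le_two (sub_nonneg.2 hst)
  set r := √(2 * t)
  obtain ⟨Φ, hΦ, hcont⟩ := exists_flow (f := descentField A p.1)
    (fun u => by rw [descentField, norm_neg]; exact norm_smul_inv_one_add_le _)
    (exists_lipschitzOnWith_descentField A hκ hx) (Real.sqrt_nonneg (2 * t)) hT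
  have hsub : sublevel A p t ⊆ Metric.closedBall 0 r := by
    intro u hu
    rw [mem_closedBall_zero_iff]
    refine Real.le_sqrt_of_sq_le ?_
    have := hu.2
    rw [energy] at this
    linarith
  have hfibre : ∀ u ∈ sublevel A p t, ∀ τ ∈ Set.Icc 0 T, endpointMap A (Φ (u, τ)) = p ∧
      HasDerivWithinAt (fun τ => Φ (u, τ)) (-((1 + ‖tangentGradient A (Φ (u, τ))‖)⁻¹ •
        tangentGradient A (Φ (u, τ)))) (Set.Icc 0 T) τ := by
    intro u hu
    obtain ⟨h0, hd⟩ := hΦ u (hsub hu)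
    have htot : ∀ τ ∈ Set.Icc 0 T, total (Φ (u, τ)) = p.1 := by
      intro τ hτ
      rw [eq_of_hasDerivWithinAt_zero (g := fun τ => total (Φ (u, τ))) (T := T) (fun σ hσ => ?_) hτ,
        h0, ← fst_endpointMap A, hu.1]
      have := total.hasFDerivAt.comp_hasDerivWithinAt σ (hd σ hσ)
      rwa [descentField, map_neg, map_smul, total_tangentGradient, smul_zero, neg_zero] at this
    have hd' : ∀ τ ∈ Set.Icc 0 T, HasDerivWithinAt (fun τ => Φ (u, τ))
        (-((1 + ‖tangentGradient A (Φ (u, τ))‖)⁻¹ • tangentGradient A (Φ (u, τ))))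
        (Set.Icc 0 T) τ := by
      intro τ hτ
      have := hd τ hτ
      rwa [descentField, withTotal_of_total_eq (htot τ hτ)] at this
    refine fun τ hτ => ⟨?_, hd' τ hτ⟩
    rw [eq_of_hasDerivWithinAt_zero (g := fun τ => endpointMap A (Φ (u, τ))) (T := T)
      (fun σ hσ => ?_) hτ, h0, hu.1]
    have := ((contDiff_endpointMap A).differentiable one_ne_zero
      (Φ (u, σ))).hasFDerivAt.comp_hasDerivWithinAt σ (hd' σ hσ)
    rwa [map_neg, map_smul, fderiv_endpointMap_tangentGradient, smul_zero, neg_zero] at this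
  have henergy : ∀ u ∈ sublevel A p t, ∀ τ ∈ Set.Icc 0 T,
      HasDerivWithinAt (fun τ => energy (Φ (u, τ))) (-((1 + ‖tangentGradient A (Φ (u, τ))‖)⁻¹ *
        ‖tangentGradient A (Φ (u, τ))‖ ^ 2)) (Set.Icc 0 T) τ := by
    intro u hu τ hτ
    have := ((hfibre u hu τ hτ).2.norm_sq).div_const 2
    rw [inner_neg_right, real_inner_smul_right, inner_self_tangentGradient] at this
    refine this.congr_deriv ?_
    ring
  have hanti : ∀ u ∈ sublevel A p t, AntitoneOn (fun τ => energy (Φ (u, τ))) (Set.Icc 0 T) :=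
    fun u hu => antitoneOn_Icc_of_hasDerivWithinAt_nonpos (henergy u hu)
      fun τ _ => neg_nonpos.2 (by positivity)
  have hle : ∀ u ∈ sublevel A p t, ∀ τ ∈ Set.Icc 0 T, energy (Φ (u, τ)) ≤ energy u := by
    intro u hu τ hτ
    have h := hanti u hu (Set.left_mem_Icc.2 hT) hτ hτ.1
    simpa only [(hΦ u (hsub hu)).1] using h
  refine isIso_singularHomology_inclusion (sublevel_mono A p hst) hT Φ
    (hcont.mono (Set.prod_mono hsub le_rfl)) (fun u hu => (hΦ u (hsub hu)).1)
    (fun u hu τ hτ => ⟨(hfibre u hu τ hτ).1, (hle u hu τ hτ).trans hu.2⟩)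
    (fun u hu τ hτ => ⟨(hfibre u (sublevel_mono A p hst hu) τ hτ).1,
      (hle u (sublevel_mono A p hst hu) τ hτ).trans hu.2⟩) (fun u hu => ?_) R n
  refine ⟨(hfibre u hu T (Set.right_mem_Icc.2 hT)).1, ?_⟩
  by_contra! hcon
  -- as long as the energy exceeds `s ≥ s₀` it decreases at rate at least `1 / 2`
  have hrate : AntitoneOn (fun τ => energy (Φ (u, τ)) + τ / 2) (Set.Icc 0 T) := by
    refine antitoneOn_Icc_of_hasDerivWithinAt_nonpos
      (fun τ hτ => (henergy u hu τ hτ).add ((hasDerivWithinAt_id τ _).div_const 2)) fun τ hτ => ?_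
    have h1 : s₀ < energy (Φ (u, τ)) :=
      hs.trans_lt (hcon.trans_le (hanti u hu hτ (Set.right_mem_Icc.2 hT) hτ.2))
    have h2 := hs₀ _ (hfibre u hu τ hτ).1 h1
    set g := ‖tangentGradient A (Φ (u, τ))‖
    have h3 : 1 / 2 ≤ (1 + g)⁻¹ * g ^ 2 := by
      rw [inv_mul_eq_div, div_le_div_iff₀ two_pos (by linarith)]
      nlinarith
    linarith
  have h := hrate (Set.left_mem_Icc.2 hT) (Set.right_mem_Icc.2 hT) hT
  simp only [(hΦ u (hsub hu)).1] at h
  have := hu.2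
  linarith

/-! ### The exponential map -/

theorem norm_horizontalPart_pow_le (S : V d →L[ℝ] V d) (u : Control d) (n : ℕ) :
    ∀ t ∈ Set.Icc 0 (2 * Real.pi),
      ‖horizontalPart (((pointwise S ∘L primitive) ^ n) u) t‖ ≤
        ‖S‖ ^ n * (t ^ n / n.factorial) * (√(2 * Real.pi) * ‖u‖) := by
  induction n with
  | zero => intro t ht; simpa using norm_horizontalPart_le u ht
  | succ n ih =>
    intro t ht
    set w := ((pointwise S ∘L primitive) ^ n) u
    rw [pow_succ', mul_apply_eq_comp, ContinuousLinearMap.comp_apply,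
      horizontalPart_pointwise S _ ht, horizontalPart_congr (primitive_coeFn w) ht]
    have hint : ‖∫ τ in (0 : ℝ)..t, horizontalPart w τ‖ ≤
        ∫ τ in (0 : ℝ)..t, ‖S‖ ^ n * (τ ^ n / n.factorial) * (√(2 * Real.pi) * ‖u‖) := by
      refine intervalIntegral.norm_integral_le_of_norm_le ht.1
        (Filter.Eventually.of_forall fun τ hτ => ih τ ⟨hτ.1.le, hτ.2.trans ht.2⟩) ?_
      exact Continuous.intervalIntegrable (by fun_prop) _ _
    refine (S.le_opNorm _).trans ((mul_le_mul_of_nonneg_left hint (norm_nonneg S)).trans_eq ?_)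
    rw [intervalIntegral.integral_mul_const, intervalIntegral.integral_const_mul,
      intervalIntegral.integral_div, integral_pow, Nat.factorial_succ]
    push_cast
    have : ((n : ℝ) + 1) ≠ 0 := by positivity
    have : (n.factorial : ℝ) ≠ 0 := by positivity
    simp only [ne_eq, Nat.succ_ne_zero, not_false_eq_true, zero_pow, sub_zero]
    field_simp
    ring

/-- Volterra operators are quasi-nilpotent, so `u + S ∫₀ᵗ u = h` is uniquely solvable. -/
theorem isUnit_one_add_volterra (S : V d →L[ℝ] V d) :
    IsUnit (1 + (pointwise S ∘L primitive : Control d →L[ℝ] Control d)) := by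
  set N : Control d →L[ℝ] Control d := pointwise S ∘L primitive
  have hpow : ∀ n : ℕ, ‖N ^ (n + 1)‖ ≤
      2 * Real.pi * ‖S‖ * ((2 * Real.pi * ‖S‖) ^ n / n.factorial) := by
    intro n
    refine ContinuousLinearMap.opNorm_le_bound _ (by positivity) fun u => ?_
    rw [pow_succ', mul_apply_eq_comp]
    set w := (N ^ n) u
    have h1 : ‖primitive w‖ ≤ √(2 * Real.pi) *
        (‖S‖ ^ n * ((2 * Real.pi) ^ n / n.factorial) * (√(2 * Real.pi) * ‖u‖)) := by
      refine norm_le_of_forall_norm_le (by positivity) ?_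
      filter_upwards [ae_mem_Icc, primitive_coeFn w] with t ht h2
      rw [h2]
      refine (norm_horizontalPart_pow_le S u n t ht).trans ?_
      gcongr
      · exact ht.1
      · exact ht.2
    refine (norm_pointwise_le S _).trans ((mul_le_mul_of_nonneg_left h1 (norm_nonneg S)).trans_eq ?_)
    have h3 := Real.mul_self_sqrt Real.two_pi_pos.le
    rw [mul_pow]
    linear_combination ‖S‖ * (‖S‖ ^ n * ((2 * Real.pi) ^ n / n.factorial)) * ‖u‖ * h3
  have hlim : Filter.Tendsto (fun n : ℕ => 2 * Real.pi * ‖S‖ *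
      ((2 * Real.pi * ‖S‖) ^ n / n.factorial)) Filter.atTop (nhds 0) := by
    simpa using (FloorSemiring.tendsto_pow_div_factorial_atTop (2 * Real.pi * ‖S‖)).const_mul
      (2 * Real.pi * ‖S‖)
  obtain ⟨n, hn⟩ := (hlim.eventually (gt_mem_nhds one_pos)).exists
  have hu : IsUnit (1 - (-N) ^ (n + 1)) := by
    refine isUnit_one_sub_of_norm_lt_one (lt_of_le_of_lt ?_ hn)
    rcases neg_one_pow_eq_or (Control d →L[ℝ] Control d) (n + 1) with h | h <;>
      rw [neg_pow, h]
    · rw [one_mul]; exact hpow n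
    · rw [neg_one_mul, norm_neg]; exact hpow n
  rw [← mul_neg_geom_sum] at hu
  have hc : Commute (1 - -N) (∑ i ∈ Finset.range (n + 1), (-N) ^ i) :=
    Commute.sum_right _ _ _ fun i _ =>
      ((Commute.one_left _).sub_left ((Commute.refl (-N)).pow_right i))
  have := (hc.isUnit_mul_iff.1 hu).1
  rwa [sub_neg_eq_add] at this

/-- The operator `u ↦ B_ω ∫₀ᵗ u`, as a linear function of `ω`. -/
def volterra (A : Fin l → so d) : W l →L[ℝ] Control d →L[ℝ] Control d :=
  LinearMap.toContinuousLinearMap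
    { toFun := fun ω => pointwise (pencil A ω) ∘L primitive
      map_add' := fun ω ω' => by rw [map_add, map_add, ContinuousLinearMap.add_comp]
      map_smul' := fun c ω => by
        rw [map_smul, map_smul, ContinuousLinearMap.smul_comp, RingHom.id_apply] }

theorem volterra_apply (A : Fin l → so d) (ω : W l) (u : Control d) :
    volterra A ω u = pointwise (pencil A ω) (primitive u) := rfl

theorem isUnit_one_add_volterra_apply (A : Fin l → so d) (ω : W l) :
    IsUnit (1 + volterra A ω) :=
  isUnit_one_add_volterra (pencil A ω)

/-- The control of the normal extremal with initial velocity `c` and vertical covector `ω`: the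
solution of `u(t) = c - B_ω ∫₀ᵗ u`. -/
def extremal (A : Fin l → so d) (q : G d l) : Control d :=
  Ring.inverse (1 + volterra A q.2) (const q.1)

theorem extremal_eq (A : Fin l → so d) (q : G d l) :
    extremal A q = const q.1 - pointwise (pencil A q.2) (primitive (extremal A q)) := by
  have h := Ring.mul_inverse_cancel _ (isUnit_one_add_volterra_apply A q.2)
  have h2 := DFunLike.congr_fun h (const q.1)
  rw [mul_apply_eq_comp, one_apply_eq_self] at h2
  rw [← volterra_apply, eq_sub_iff_add_eq]
  exact h2

theorem eq_extremal {A : Fin l → so d} {u : Control d} {c : V d} {ω : W l}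
    (h : u = const c - pointwise (pencil A ω) (primitive u)) : u = extremal A (c, ω) := by
  rw [← volterra_apply, eq_sub_iff_add_eq] at h
  have h1 : (1 + volterra A ω) u = const c := h
  rw [extremal, ← h1, ← mul_apply_eq_comp,
    Ring.inverse_mul_cancel _ (isUnit_one_add_volterra_apply A ω), one_apply_eq_self]

/-- The exponential map, which sends the initial data of a normal extremal to its end-point. -/
def expMap (A : Fin l → so d) (q : G d l) : G d l := endpointMap A (extremal A q)

theorem contDiff_expMap (A : Fin l → so d) : ContDiff ℝ 1 (expMap A) := by
  refine (contDiff_endpointMap A).comp (ContDiff.clm_apply ?_ (const.contDiff.comp contDiff_fst))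
  rw [contDiff_iff_contDiffAt]
  intro q
  obtain ⟨U, hU⟩ := isUnit_one_add_volterra_apply A q.2
  have h1 : ContDiffAt ℝ 1 (fun q : G d l => 1 + volterra A q.2) q :=
    contDiffAt_const.add ((volterra A).contDiff.comp contDiff_snd).contDiffAt
  have h2 : ContDiffAt ℝ 1 Ring.inverse (1 + volterra A q.2) := hU ▸ contDiffAt_ringInverse ℝ U
  exact h2.comp q h1

theorem exists_expMap_eq_of_mem_geodesics {A : Fin l → so d} {p : G d l} {u : Control d}
    (hu : u ∈ geodesics A p) : ∃ q, expMap A q = p ∧ extremal A q = u := by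
  obtain ⟨ζ, hζ⟩ := exists_eq_gradient_of_mem_geodesics hu
  have h := eq_extremal (hζ.trans (gradient_apply A u ζ))
  exact ⟨_, by rw [expMap, ← h, hu.1], h.symm⟩

/-- The exponential map is proper over the nondegenerate points. -/
theorem exists_norm_le_of_expMap (A : Fin l → so d) {κ R : ℝ} (hκ : 0 < κ) (hR : 0 ≤ R) :
    ∃ C, ∀ q, (∀ ω, κ * ‖ω‖ ≤ ‖pencil A ω (expMap A q).1‖) → ‖expMap A q‖ ≤ R → ‖q‖ ≤ C := by
  obtain ⟨C, -, hC⟩ := exists_bound_of_almost_critical A hκ hR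
  refine ⟨C, fun q hx hq => ?_⟩
  have h := hC (extremal A q) 0 q.1 q.2 (by
    rw [← fst_endpointMap A]; exact hx q.2) hq (by
    rw [add_zero]; exact extremal_eq A q) (by simp)
  exact max_le h.2.1 h.2.2

/-- The critical points of the exponential map. -/
def criticalSet (A : Fin l → so d) : Set (G d l) := {q | (fderiv ℝ (expMap A) q).det = 0}

theorem isClosed_criticalSet (A : Fin l → so d) : IsClosed (criticalSet A) :=
  isClosed_eq (ContinuousLinearMap.continuous_det.comp
    ((contDiff_expMap A).continuous_fderiv one_ne_zero)) continuous_const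

theorem volume_image_criticalSet (A : Fin l → so d) :
    volume (expMap A '' criticalSet A) = 0 := by
  have : (volume : Measure (G d l)).IsAddHaarMeasure :=
    inferInstanceAs (((volume : Measure (V d)).prod (volume : Measure (W l))).IsAddHaarMeasure)
  exact addHaar_image_eq_zero_of_det_fderivWithin_eq_zero volume
    (fun q _ => ((contDiff_expMap A).differentiable one_ne_zero q).hasFDerivAt.hasFDerivWithinAt)
    fun q hq => hq

/-- Over a nondegenerate regular value of the exponential map there are finitely many geodesics: the
fibre is compact by the a priori bound, and has no accumulation point. -/
theorem finite_geodesics {A : Fin l → so d} {p : G d l} {κ : ℝ} (hκ : 0 < κ)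
    (hx : ∀ ω, κ * ‖ω‖ ≤ ‖pencil A ω p.1‖) (hp : p ∉ expMap A '' criticalSet A) :
    (geodesics A p).Finite := by
  have hfin : (expMap A ⁻¹' {p}).Finite := by
    by_contra hinf
    obtain ⟨C, hC⟩ := exists_norm_le_of_expMap A hκ (norm_nonneg p)
    have hcpt : IsCompact (expMap A ⁻¹' {p}) := by
      refine Metric.isCompact_of_isClosed_isBounded
        (isClosed_singleton.preimage (contDiff_expMap A).continuous)
        ((Metric.isBounded_closedBall (x := (0 : G d l)) (r := C)).subset fun q hq => ?_)
      rw [Set.mem_preimage, Set.mem_singleton_iff] at hq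
      exact mem_closedBall_zero_iff.2 (hC q (by rwa [hq]) (by rw [hq]))
    obtain ⟨q, hq, hacc⟩ := Set.Infinite.exists_accPt_of_subset_isCompact hinf hcpt le_rfl
    have hdet : (fderiv ℝ (expMap A) q).det ≠ 0 := fun h => hp ⟨q, h, hq⟩
    have hker : LinearMap.ker (fderiv ℝ (expMap A) q).toLinearMap = ⊥ :=
      (LinearMap.isUnit_iff_ker_eq_bot _).1
        ((LinearMap.isUnit_iff_isUnit_det _).2 (isUnit_iff_ne_zero.2 hdet))
    obtain ⟨K, -, hK⟩ := LinearMap.exists_antilipschitzWith _ hker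
    have hne := ((contDiff_expMap A).differentiable one_ne_zero q).hasFDerivAt.eventually_ne
      (c := p) ⟨K, hK⟩
    rw [accPt_iff_frequently_nhdsNE] at hacc
    exact hacc (hne.mono fun z hz h => hz h)
  refine (hfin.image (extremal A)).subset fun u hu => ?_
  obtain ⟨q, hq, rfl⟩ := exists_expMap_eq_of_mem_geodesics hu
  exact ⟨q, hq, rfl⟩

/-! ### Nondegenerate horizontal vectors -/

/-- The vectors `x` for which `A₁ x, …, A_l x` are linearly independent. -/
def nondegenerate (A : Fin l → so d) : Set (V d) :=
  {x | ∀ ω, pencil A ω x = 0 → ω = 0}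

theorem exists_mul_norm_le_of_mem_nondegenerate {A : Fin l → so d} {x : V d}
    (hx : x ∈ nondegenerate A) : ∃ κ, 0 < κ ∧ ∀ ω, κ * ‖ω‖ ≤ ‖pencil A ω x‖ := by
  have hker : LinearMap.ker ((pencil A).flip x).toLinearMap = ⊥ :=
    LinearMap.ker_eq_bot'.2 fun ω h => hx ω h
  obtain ⟨K, hK0, hK⟩ := LinearMap.exists_antilipschitzWith _ hker
  have hK0' : (0 : ℝ) < K := hK0
  refine ⟨(K : ℝ)⁻¹, inv_pos.2 hK0', fun ω => ?_⟩
  rw [inv_mul_le_iff₀ hK0']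
  exact hK.le_mul_norm (map_zero _) ω

theorem mem_nondegenerate_of_mul_norm_le {A : Fin l → so d} {x : V d} {κ : ℝ} (hκ : 0 < κ)
    (hx : ∀ ω, κ * ‖ω‖ ≤ ‖pencil A ω x‖) : x ∈ nondegenerate A := by
  intro ω h
  have := hx ω
  rw [h, norm_zero] at this
  exact norm_eq_zero.1 (le_antisymm (nonpos_of_mul_nonpos_right this hκ) (norm_nonneg ω))

/-- The lower bound in the definition of nondegeneracy is locally uniform. -/
theorem exists_eventually_mul_norm_le {A : Fin l → so d} {x : V d} (hx : x ∈ nondegenerate A) :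
    ∃ κ, 0 < κ ∧ ∀ᶠ x' in nhds x, ∀ ω, κ * ‖ω‖ ≤ ‖pencil A ω x'‖ := by
  obtain ⟨κ, hκ, h⟩ := exists_mul_norm_le_of_mem_nondegenerate hx
  refine ⟨κ / 2, half_pos hκ, ?_⟩
  have hc : Filter.Tendsto (fun x' => ‖pencil A‖ * ‖x - x'‖) (nhds x) (nhds 0) := by
    have : Continuous fun x' => ‖pencil A‖ * ‖x - x'‖ := by fun_prop
    simpa using this.tendsto x
  filter_upwards [hc.eventually (gt_mem_nhds (half_pos hκ))] with x' hx' ω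
  have h1 := norm_pencil_le A ω (x - x')
  rw [map_sub] at h1
  have h2 := norm_sub_norm_le (pencil A ω x) (pencil A ω x')
  nlinarith [h ω, norm_nonneg ω]

theorem isOpen_nondegenerate (A : Fin l → so d) : IsOpen (nondegenerate A) := by
  refine isOpen_iff_mem_nhds.2 fun x hx => ?_
  obtain ⟨κ, hκ, h⟩ := exists_eventually_mul_norm_le hx
  exact h.mono fun x' hx' => mem_nondegenerate_of_mul_norm_le hκ hx'

/-- On a line of linear maps in the direction of an injective one, all but finitely many members are
injective: after composition with a left inverse `Λ` of `L₀`, the others give eigenvalues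
of `Λ ∘ L`. -/
theorem finite_setOf_not_injective_add_smul {U U' : Type*} [AddCommGroup U] [Module ℝ U]
    [FiniteDimensional ℝ U] [AddCommGroup U'] [Module ℝ U'] (L L₀ : U →ₗ[ℝ] U')
    (h₀ : ∀ ω, L₀ ω = 0 → ω = 0) :
    {t : ℝ | ¬ ∀ ω, L ω + t • L₀ ω = 0 → ω = 0}.Finite := by
  obtain ⟨Λ, hΛ⟩ := L₀.exists_leftInverse_of_injective (LinearMap.ker_eq_bot'.2 h₀)
  refine ((Module.End.finite_spectrum (Λ ∘ₗ L)).preimage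
    (neg_injective (G := ℝ)).injOn).subset fun t ht => ?_
  simp only [Set.mem_ofPred_eq, not_forall] at ht
  obtain ⟨ω, hω, hω0⟩ := ht
  refine Module.End.HasEigenvalue.mem_spectrum
    (Module.End.hasEigenvalue_of_hasEigenvector (x := ω) ⟨?_, hω0⟩)
  have h1 := congrArg Λ hω
  rw [map_add, map_smul, map_zero, ← LinearMap.comp_apply Λ L₀, hΛ, LinearMap.id_apply] at h1
  rw [Module.End.mem_eigenspace_iff, neg_smul]
  exact eq_neg_of_add_eq_zero_left h1

theorem volume_compl_nondegenerate {A : Fin l → so d} (h : (nondegenerate A).Nonempty) :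
    volume (nondegenerate A)ᶜ = 0 := by
  obtain ⟨x₀, hx₀⟩ := h
  refine ae_mem_of_ae_add_linearMap_mem (LinearMap.toSpanSingleton ℝ (V d) x₀) volume volume
    (isOpen_nondegenerate A).measurableSet fun y => ?_
  have hfin := finite_setOf_not_injective_add_smul ((pencil A).flip y).toLinearMap
    ((pencil A).flip x₀).toLinearMap hx₀
  filter_upwards [compl_mem_ae_iff.2 (hfin.measure_zero volume)] with t ht ω hω
  refine not_not.1 ht ω ?_
  simpa using hω

/-! ### Generic structures -/

theorem mem_nondegenerate_iff {A : Fin l → so d} {x : V d} :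
    x ∈ nondegenerate A ↔ LinearIndependent ℝ fun k => soMap d (A k) x := by
  rw [Fintype.linearIndependent_iff]
  constructor
  · intro h g hg k
    have h1 := h (WithLp.toLp 2 g) (by simpa [pencil_apply] using hg)
    simpa using congrArg (fun ω : W l => ω k) h1
  · intro h ω hω
    ext k
    exact h (fun k => ω k) (by simpa [pencil_apply] using hω) k

/-- The subspaces of `𝔰𝔬(d)` on which the evaluation at some vector is injective. -/
def separatedStructures (d : ℕ) : Set (Submodule ℝ (so d)) :=
  {U | ∃ x : V d, ∀ a ∈ U, soMap d a x = 0 → a = 0}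

theorem soMap_sum (A : Fin l → so d) (ω : W l) :
    soMap d (∑ k, (ω k : ℝ) • A k) = pencil A ω := by
  rw [pencil_apply, map_sum]
  exact Finset.sum_congr rfl fun k _ => map_smul _ _ _

theorem mem_basesIn_separatedStructures {A : Fin l → so d} :
    A ∈ basesIn l (separatedStructures d) ↔ (nondegenerate A).Nonempty := by
  constructor
  · rintro ⟨hA, x, hx⟩
    refine ⟨x, fun ω hω => ?_⟩
    have h1 := hx (∑ k, (ω k : ℝ) • A k)
      (Submodule.sum_mem _ fun k _ => Submodule.smul_mem _ _ (Submodule.subset_span ⟨k, rfl⟩))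
      (by rw [soMap_sum, hω])
    ext k
    exact Fintype.linearIndependent_iff.1 hA (fun k => ω k) h1 k
  · rintro ⟨x, hx⟩
    refine ⟨?_, x, fun a ha h0 => ?_⟩
    · exact (mem_nondegenerate_iff.1 hx).of_comp
        ((LinearMap.applyₗ x).comp (ContinuousLinearMap.coeLM ℝ) ∘ₗ soMap d)
    · obtain ⟨g, rfl⟩ := (Submodule.mem_span_range_iff_exists_fun ℝ).1 ha
      have h1 := hx (WithLp.toLp 2 g) (by rw [← soMap_sum]; exact h0)
      refine Finset.sum_eq_zero fun k _ => ?_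
      rw [show g k = 0 by simpa using congrArg (fun ω : W l => ω k) h1, zero_smul]

theorem continuous_soMap_apply (x : V d) : Continuous fun a : so d => soMap d a x := by
  have h : Continuous fun M : Matrix (Fin d) (Fin d) ℝ => Matrix.toEuclideanLin M x :=
    LinearMap.continuous_of_finiteDimensional
      ((LinearMap.applyₗ x).comp (Matrix.toEuclideanLin (𝕜 := ℝ)).toLinearMap)
  exact h.comp continuous_subtype_val

theorem isOpen_basesIn_separatedStructures (d l : ℕ) :
    IsOpen (basesIn l (separatedStructures d)) := by
  have h : basesIn l (separatedStructures d) = ⋃ x : V d,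
      {A | LinearIndependent ℝ fun k => soMap d (A k) x} := by
    ext A
    rw [mem_basesIn_separatedStructures, Set.mem_iUnion]
    exact exists_congr fun x => mem_nondegenerate_iff
  rw [h]
  refine isOpen_iUnion fun x => isOpen_setOfPred_linearIndependent.preimage ?_
  exact continuous_pi fun k => (continuous_soMap_apply x).comp (continuous_apply k)

/-- The infinitesimal rotations in the coordinate planes `(0, k + 1)`. -/
def rotations (h : l < d) (k : Fin l) : so d :=
  let i₀ : Fin d := ⟨0, Nat.zero_lt_of_lt h⟩
  let i : Fin d := ⟨k + 1, Nat.lt_of_le_of_lt k.2 h⟩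
  ⟨Matrix.single i i₀ 1 - Matrix.single i₀ i 1, (LieAlgebra.Orthogonal.mem_so (Fin d) ℝ _).2 (by
    rw [Matrix.transpose_sub, Matrix.transpose_single, Matrix.transpose_single, neg_sub])⟩

theorem single_zero_mem_nondegenerate_rotations (h : l < d) :
    EuclideanSpace.single (⟨0, Nat.zero_lt_of_lt h⟩ : Fin d) (1 : ℝ) ∈
      nondegenerate (rotations h) := by
  rw [mem_nondegenerate_iff]
  have h1 : (fun k => soMap d (rotations h k)
      (EuclideanSpace.single ⟨0, Nat.zero_lt_of_lt h⟩ 1)) =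
      fun k : Fin l => EuclideanSpace.single (⟨k + 1, Nat.lt_of_le_of_lt k.2 h⟩ : Fin d) (1 : ℝ) := by
    funext k
    ext i
    simp [soMap_apply, rotations, Matrix.toLpLin_apply, Matrix.single_apply, Fin.ext_iff, eq_comm]
  rw [h1, Fintype.linearIndependent_iff]
  intro g hg k
  have h2 := congrArg (fun v : V d => v ⟨k + 1, Nat.lt_of_le_of_lt k.2 h⟩) hg
  simpa [Finset.sum_apply, Pi.single_apply, Fin.ext_iff, ← Fin.ext_iff] using h2

theorem dense_basesIn_separatedStructures (h : l < d) :
    Dense (basesIn l (separatedStructures d)) := by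
  intro A
  set x₀ := EuclideanSpace.single (⟨0, Nat.zero_lt_of_lt h⟩ : Fin d) (1 : ℝ)
  set F := {t : ℝ | ¬ ∀ ω, ((pencil A).flip x₀).toLinearMap ω +
    t • ((pencil (rotations h)).flip x₀).toLinearMap ω = 0 → ω = 0}
  have hF : F.Finite := finite_setOf_not_injective_add_smul _ _
    (single_zero_mem_nondegenerate_rotations h)
  have hcont : Continuous fun (t : ℝ) (k : Fin l) => A k + t • rotations h k := by
    refine continuous_pi fun k => Continuous.subtype_mk (f := fun t : ℝ =>
      (A k : Matrix (Fin d) (Fin d) ℝ) + t • (rotations h k : Matrix (Fin d) (Fin d) ℝ)) ?_ _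
    fun_prop
  have hlim : Filter.Tendsto (fun (t : ℝ) (k : Fin l) => A k + t • rotations h k)
      (nhdsWithin 0 {0}ᶜ) (nhds A) := by
    have := hcont.tendsto 0
    simp only [zero_smul, add_zero] at this
    exact this.mono_left nhdsWithin_le_nhds
  refine mem_closure_of_tendsto hlim ?_
  have hev : ∀ᶠ t in nhdsWithin (0 : ℝ) {0}ᶜ, t ∉ F := by
    have h1 : (F \ {0})ᶜ ∈ nhds (0 : ℝ) :=
      (hF.subset Set.sdiff_subset).isClosed.isOpen_compl.mem_nhds (by simp)
    filter_upwards [mem_nhdsWithin_of_mem_nhds h1, self_mem_nhdsWithin] with t h2 h3 h4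
    exact h2 ⟨h4, h3⟩
  refine hev.mono fun t ht => mem_basesIn_separatedStructures.2 ⟨x₀, fun ω hω => ?_⟩
  refine not_not.1 ht ω ?_
  rw [← hω]
  simp [pencil_apply, smul_add, Finset.sum_add_distrib, Finset.smul_sum, smul_comm t]

/-! ### Regular end-points -/

theorem isRegularEndpoint_of_mem_nondegenerate {A : Fin l → so d} {p : G d l}
    (hp : p.1 ∈ nondegenerate A) : IsRegularEndpoint A p := by
  obtain ⟨κ, hκ, hx⟩ := exists_mul_norm_le_of_mem_nondegenerate hp
  intro u hu
  obtain ⟨C, -, hC⟩ := exists_norm_le_mul_norm_gradient A hκ (norm_nonneg u)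
  refine surjective_fderiv_endpointMap ((injective_iff_map_eq_zero _).2 fun ζ hζ => ?_)
  have h := hC u (by rwa [← fst_endpointMap A, hu]) le_rfl ζ
  rw [hζ, norm_zero, mul_zero] at h
  exact norm_le_zero_iff.1 h

/-- The points at which finiteness and stabilization may fail. -/
def exceptionalSet (A : Fin l → so d) : Set (G d l) :=
  Prod.fst ⁻¹' (nondegenerate A)ᶜ ∪ expMap A '' criticalSet A

theorem isClosed_exceptionalSet (A : Fin l → so d) : IsClosed (exceptionalSet A) := by
  refine isClosed_of_closure_subset fun p hp => ?_
  by_cases hgood : p.1 ∈ nondegenerate A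
  swap
  · exact Or.inl hgood
  obtain ⟨κ, hκ, hev⟩ := exists_eventually_mul_norm_le hgood
  obtain ⟨C, hC⟩ := exists_norm_le_of_expMap A hκ (by positivity : 0 ≤ ‖p‖ + 1)
  -- near `p` all critical values come from critical points in one compact ball
  have hcpt : IsClosed (expMap A '' (criticalSet A ∩ Metric.closedBall 0 C)) :=
    (((isCompact_closedBall _ _).inter_left (isClosed_criticalSet A)).image
      (contDiff_expMap A).continuous).isClosed
  have hnear : ∀ᶠ p' in nhds p, (∀ ω, κ * ‖ω‖ ≤ ‖pencil A ω p'.1‖) ∧ ‖p'‖ ≤ ‖p‖ + 1 :=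
    (continuous_fst.tendsto p |>.eventually hev).and
      ((continuous_norm.tendsto p).eventually (ge_mem_nhds (lt_add_one _)))
  have hmem : p ∈ closure (expMap A '' (criticalSet A ∩ Metric.closedBall 0 C)) := by
    rw [mem_closure_iff_frequently] at hp ⊢
    refine (hp.and_eventually hnear).mono ?_
    rintro p' ⟨h | ⟨q, hq, rfl⟩, hx, hn⟩
    · exact absurd (mem_nondegenerate_of_mul_norm_le hκ hx) h
    · exact ⟨q, ⟨hq, mem_closedBall_zero_iff.2 (hC q hx hn)⟩, rfl⟩
  rw [hcpt.closure_eq] at hmem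
  exact Or.inr (Set.image_mono Set.inter_subset_left hmem)

theorem volume_exceptionalSet {A : Fin l → so d} (h : (nondegenerate A).Nonempty) :
    volume (exceptionalSet A) = 0 :=
  measure_union_null
    ((Measure.quasiMeasurePreserving_fst (μ := (volume : Measure (V d)))
      (ν := (volume : Measure (W l)))).preimage_null (volume_compl_nondegenerate h))
    (volume_image_criticalSet A)

end StepTwoCarnot

end

theorem mainTheorem9 (d l : ℕ) (hdl : l < d) :
    ∃ 𝒲 : Set (Submodule ℝ (StepTwoCarnot.so d)),
      StepTwoCarnot.IsGenericStructure l 𝒲 ∧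
      ∀ A : Fin l → StepTwoCarnot.so d,
        LinearIndependent ℝ A →
        Submodule.span ℝ (Set.range A) ∈ 𝒲 →
        StepTwoCarnot.ForGenericNonvertical fun p : StepTwoCarnot.G d l =>
          StepTwoCarnot.IsRegularEndpoint A p ∧
          (StepTwoCarnot.geodesics A p).Finite ∧
          ∃ s₀ : ℝ, ∀ (s t : ℝ) (_ : s₀ ≤ s) (hst : s ≤ t)
            (R : Type) [CommRing R] (n : ℕ),
            CategoryTheory.IsIso (StepTwoCarnot.sublevelHomologyMap R n A p hst) := by
  refine ⟨StepTwoCarnot.separatedStructures d,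
    ⟨StepTwoCarnot.isOpen_basesIn_separatedStructures d l,
      StepTwoCarnot.dense_basesIn_separatedStructures hdl⟩, fun A hA hspan => ?_⟩
  refine ⟨StepTwoCarnot.exceptionalSet A, StepTwoCarnot.isClosed_exceptionalSet A,
    StepTwoCarnot.volume_exceptionalSet
      (StepTwoCarnot.mem_basesIn_separatedStructures.1 ⟨hA, hspan⟩), fun p _ hp => ?_⟩
  have hgood : p.1 ∈ StepTwoCarnot.nondegenerate A := not_not.1 fun h => hp (Or.inl h)
  obtain ⟨κ, hκ, hx⟩ := StepTwoCarnot.exists_mul_norm_le_of_mem_nondegenerate hgood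
  exact ⟨StepTwoCarnot.isRegularEndpoint_of_mem_nondegenerate hgood,
    StepTwoCarnot.finite_geodesics hκ hx fun h => hp (Or.inr h),
    StepTwoCarnot.exists_forall_isIso_sublevelHomologyMap A hκ hx⟩
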